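/- Lemma. Let $\Omega\subset\mathbb R^N$ be a bounded domain (open, connected, nonempty), let $f\in L^q(\Omega)$ for some $q\in[1,\infty]$, and let $u\in W^{1,2}_0(\Omega)$ be a weak solution of $-\Delta u=f$ in $\Omega$, $u=0$ on $\partial\Omega$, i.e. $\int_\Omega\nabla u\cdot\nabla\varphi\,dx=\int_\Omega f\varphi\,dx$ for all $\varphi\in C_c^\infty(\Omega)$. Let $x_0\in\overline\Omega$, and for $r>0$ put $\Omega_r^+=B(x_0,r)\cap\Omega$ and $S_r^+=\partial B(x_0,r)\cap\Omega$. Let $$\sigma(r)=\inf\Big\{\frac{\int_{S_r^+}|\nabla_\tau v|^2\,dS}{\int_{S_r^+}v^2\,dS}\ :\ v\in C_c^\infty(S_r^+),\ v\not\equiv0\Big\}\in[0,+\infty]$$ be the first Dirichlet eigenvalue of the Laplace operator on the spherical domain $S_r^+$, where $\nabla_\tau$ is the tangential gradient on the sphere ($\sigma(r)=+\infty$ if $S_r^+=\emptyset$). Suppose that there are $r_0>0$ and $\sigma^*\in(0,N-1)$ such that $$\inf_{0<r<r_0}r^2\sigma(r)\ge\sigma^*,$$ and set $\beta=\sqrt{(N-2)^2+4\sigma^*}-(N-2)$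 and $$\psi(s)=\int_{\Omega_s^+}|uf|\,|x-x_0|^{2-N}\,dx\in[0,+\infty].$$ Then $\beta\in(0,2)$, and the function $$r\mapsto\frac1{r^\beta}\int_{\Omega_r^+}\frac{|\nabla u|^2}{|x-x_0|^{N-2}}\,dx+\beta\int_0^r\frac{\psi(s)}{s^{1+\beta}}\,ds,$$ with values in $[0,+\infty]$, is nondecreasing on $(0,r_0)$. Moreover $$\int_{\Omega_{r_0/2}^+}\frac{|\nabla u|^2}{|x-x_0|^{N-2}}\,dx\le C(N,r_0,\beta)\,\|\nabla u\|_{L^2(\Omega)}^2+\psi(r_0),$$ where the constant $C(N,r_0,\beta)$ depends only on $N$, $r_0$ and $\beta$. -/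

import Mathlib

open MeasureTheory Set Filter Topology TopologicalSpace
open scoped ENNReal NNReal Distributions

noncomputable section

namespace ACF

/-- `N`-dimensional Euclidean space. -/
abbrev Euc (N : ℕ) : Type := EuclideanSpace ℝ (Fin N)

variable {N : ℕ}

/-- `G` is the weak (distributional) gradient of `u` in the open set `Ω`. -/
def HasWeakGradient (Ω : Opens (Euc N)) (u : Euc N → ℝ) (G : Euc N → Euc N) : Prop :=
  LocallyIntegrableOn u Ω ∧ LocallyIntegrableOn G Ω ∧
    ∀ (φ : 𝓓(Ω, ℝ)) (v : Euc N),
      ∫ x in Ω, u x * inner ℝ (gradient φ x) v = - ∫ x in Ω, inner ℝ (G x) v * φ x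

/-- `u ∈ W^{1,2}(Ω)`, with weak gradient `G`. -/
structure MemW12 (Ω : Opens (Euc N)) (u : Euc N → ℝ) (G : Euc N → Euc N) : Prop where
  memLp : MemLp u 2 (volume.restrict Ω)
  memLp_grad : MemLp G 2 (volume.restrict Ω)
  hasWeakGradient : HasWeakGradient Ω u G

/-- `u ∈ W_0^{1,2}(Ω)`, with weak gradient `G`: the function `u` is in the closure of
`C_c^∞(Ω)` in `W^{1,2}(Ω)`. -/
structure MemW012 (Ω : Opens (Euc N)) (u : Euc N → ℝ) (G : Euc N → Euc N) : Prop
    extends MemW12 Ω u G where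
  exists_approx : ∃ φ : ℕ → 𝓓(Ω, ℝ),
    Tendsto (fun n => eLpNorm (fun x => φ n x - u x) 2 (volume.restrict Ω)) atTop (𝓝 0) ∧
    Tendsto (fun n => eLpNorm (fun x => gradient (φ n) x - G x) 2 (volume.restrict Ω))
      atTop (𝓝 0)

/-- `u ∈ W_0^{1,2}(Ω)`, with weak gradient `G`, is a weak solution of the Dirichlet problem
`-Δ u = f` in `Ω`, `u = 0` on `∂Ω`. -/
structure IsWeakSolution (Ω : Opens (Euc N)) (f u : Euc N → ℝ) (G : Euc N → Euc N) : Prop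
    extends MemW012 Ω u G where
  weak_eq : ∀ φ : 𝓓(Ω, ℝ),
    ∫ x in Ω, inner ℝ (G x) (gradient φ x) = ∫ x in Ω, f x * φ x

/-- The surface measure of the sphere `∂B(x₀, r)`, as a measure on the ambient space: the image of
the surface measure of the unit sphere under `ω ↦ x₀ + r ω`, multiplied by `r^{N-1}`. -/
def sphereSurface (x₀ : Euc N) (r : ℝ) : Measure (Euc N) :=
  ENNReal.ofReal (r ^ ((N : ℝ) - 1)) •
    (volume : Measure (Euc N)).toSphere.map
      (fun ω : Metric.sphere (0 : Euc N) 1 => x₀ + r • (ω : Euc N))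

/-- The tangential gradient at `x ∈ ∂B(x₀, r)` of (the restriction to the sphere `∂B(x₀, r)` of)
a smooth function `v`: the gradient minus its component along `ν = (x - x₀) / r`. -/
def tangentialGradient (x₀ : Euc N) (r : ℝ) (v : Euc N → ℝ) (x : Euc N) : Euc N :=
  gradient v x - inner ℝ (gradient v x) (r⁻¹ • (x - x₀)) • (r⁻¹ • (x - x₀))

/-- The restriction of `v` to the sphere `∂B(x₀, r)` is smooth with compact support in the
spherical domain `∂B(x₀, r) ∩ Ω`. The smooth functions on the sphere are the restrictions of the
smooth functions on the ambient space. -/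
def IsSphericalTest (Ω : Set (Euc N)) (x₀ : Euc N) (r : ℝ) (v : Euc N → ℝ) : Prop :=
  ContDiff ℝ (⊤ : ℕ∞) v ∧ closure (Function.support v ∩ Metric.sphere x₀ r) ⊆ Ω

/-- The first Dirichlet eigenvalue `σ(r)` of the Laplace(-Beltrami) operator on the spherical
domain `∂B(x₀, r) ∩ Ω`: the infimum of the Rayleigh quotient over the nonzero
test functions on this domain. It is `⊤` if the spherical domain is empty. -/
def sphericalEigenvalue (Ω : Set (Euc N)) (x₀ : Euc N) (r : ℝ) : ℝ≥0∞ :=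
  ⨅ (v : Euc N → ℝ) (_ : IsSphericalTest Ω x₀ r v)
    (_ : ∫⁻ x, ENNReal.ofReal (v x ^ 2) ∂(sphereSurface x₀ r) ≠ 0),
    (∫⁻ x, ENNReal.ofReal (‖tangentialGradient x₀ r v x‖ ^ 2) ∂(sphereSurface x₀ r)) /
      ∫⁻ x, ENNReal.ofReal (v x ^ 2) ∂(sphereSurface x₀ r)

/-- The weighted energy `∫_{B(x₀, r) ∩ Ω} |∇u|² |x - x₀|^{2-N} dx`, where `G = ∇u`. -/
def weightedEnergy (Ω : Set (Euc N)) (x₀ : Euc N) (G : Euc N → Euc N) (r : ℝ) : ℝ≥0∞ :=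
  ∫⁻ x in Metric.ball x₀ r ∩ Ω, ENNReal.ofReal (‖G x‖ ^ 2 * ‖x - x₀‖ ^ (2 - (N : ℝ)))

/-- `ψ(s) = ∫_{B(x₀, s) ∩ Ω} |u f| |x - x₀|^{2-N} dx`. -/
def psi (Ω : Set (Euc N)) (x₀ : Euc N) (u f : Euc N → ℝ) (s : ℝ) : ℝ≥0∞ :=
  ∫⁻ x in Metric.ball x₀ s ∩ Ω, ENNReal.ofReal (|u x * f x| * ‖x - x₀‖ ^ (2 - (N : ℝ)))

/-- `β = √((N-2)² + 4 σ*) - (N-2)`. -/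
def betaExp (N : ℕ) (σ : ℝ) : ℝ :=
  Real.sqrt (((N : ℝ) - 2) ^ 2 + 4 * σ) - ((N : ℝ) - 2)

/-- `r ↦ r^{-β} ∫_{B(x₀, r) ∩ Ω} |∇u|² |x - x₀|^{2-N} dx + β ∫_0^r ψ(s) s^{-1-β} ds`, with values
in `[0, ∞]`. -/
def monotoneQuantity (Ω : Set (Euc N)) (x₀ : Euc N) (u f : Euc N → ℝ) (G : Euc N → Euc N)
    (β : ℝ) (r : ℝ) : ℝ≥0∞ :=
  ENNReal.ofReal (r ^ (-β)) * weightedEnergy Ω x₀ G r +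
    ENNReal.ofReal β * ∫⁻ s in Ioo (0 : ℝ) r, psi Ω x₀ u f s * ENNReal.ofReal (s ^ (-1 - β))

end ACF

end

/-! Write y = x - x₀, t = |y|², 2p = N - 2, and a = β/2, so that a(a + 2p) = σ*. Formally, the weak
equation is tested with uη, where η = t^(-p) H(t) and H is a nonincreasing cutoff. The cross term -∫
u ∇u·∇η has two pieces. Where ∇ falls on t^(-p), the identity u∇u = ∇(u²)/2 and an integration by
parts leave a superharmonicity term of good sign and 2p ∫ t^(-p) (-H') u². Where ∇ falls on H, the
inequality 2us ≤ a u² + s²/a with s = ∇u·y applies. Together the cross term is at most ∫ t^(-p)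
(-H') ((a + 2p) u² + s²/a). Since a + 2p = σ*/a, the spherical eigenvalue bound σ* ∫ κ u² ≤ ∫ κ
(t|∇u|² - s²), for radial weights κ, cancels the radial derivative exactly and bounds this by a⁻¹ ∫
t^(-p) (-H') t |∇u|².

No derivative of the energy in r is taken. Instead H is chosen so that -H' = a t^(-a-1) between r₁²
and r₂² and H' = 0 elsewhere, which gives ∫ |∇u|² |y|^(2-N) h ≤ ∫ |uf| |y|^(2-N) h + ∫_{r₁ ≤ |y| <
r₂} |∇u|² |y|^(2-N-β), where h(|y|) is the truncation of |y|^(-β) - r₂^(-β)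
(`weighted_truncatedPower_le`). Adding r₂^(-β) times the energy in B(x₀, r₂) and cancelling the
finite annulus integral yields monotonicity; Tonelli turns the source term into the integral of ψ.
Bounding the annulus integral by ‖∇u‖² instead yields the final estimate.

Three approximations make this rigorous: u is approximated by test functions and truncated by
arctan, since fu need not be integrable; the weight t^(-p) is replaced by (t + ε)^(-p); and the
ideal H is a limit of smooth cutoffs. The last two limits use Fatou's lemma, so the weighted energy
need not be known to be finite. -/

open MeasureTheory Set Filter Topology TopologicalSpace
open scoped ENNReal NNReal Distributions
noncomputable section
namespace ACF
variable {N : ℕ}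

/-! ### Passage to the limit in L² pairings. -/

section L2Limits

variable {α E F : Type*} [MeasurableSpace α] {μ : Measure α}
  [NormedAddCommGroup E] [NormedAddCommGroup F]

theorem tendsto_integral_inner [InnerProductSpace ℝ E] {f g : ℕ → α → E} {f' g' : α → E}
    (hf : ∀ n, MemLp (f n) 2 μ) (hg : ∀ n, MemLp (g n) 2 μ)
    (hf' : MemLp f' 2 μ) (hg' : MemLp g' 2 μ)
    (hff : Tendsto (fun n => eLpNorm (fun x => f n x - f' x) 2 μ) atTop (𝓝 0))
    (hgg : Tendsto (fun n => eLpNorm (fun x => g n x - g' x) 2 μ) atTop (𝓝 0)) :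
    Tendsto (fun n => ∫ x, inner ℝ (f n x) (g n x) ∂μ) atTop
      (𝓝 (∫ x, inner ℝ (f' x) (g' x) ∂μ)) := by
  have key : ∀ {a b : α → E} (ha : MemLp a 2 μ) (hb : MemLp b 2 μ),
      inner ℝ (ha.toLp a) (hb.toLp b) = ∫ x, inner ℝ (a x) (b x) ∂μ := by
    intro a b ha hb
    rw [L2.inner_def]
    refine integral_congr_ae ?_
    filter_upwards [ha.coeFn_toLp, hb.coeFn_toLp] with x h1 h2
    rw [h1, h2]
  have h1 := (Lp.tendsto_Lp_iff_tendsto_eLpNorm'' f hf f' hf').2 hff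
  have h2 := (Lp.tendsto_Lp_iff_tendsto_eLpNorm'' g hg g' hg').2 hgg
  have h3 := Filter.Tendsto.inner (𝕜 := ℝ) h1 h2
  simpa only [key] using h3

theorem tendsto_eLpNorm_sub_of_le {f : ℕ → α → E} {f' : α → E} {g : ℕ → α → F} {g' : α → F}
    (C : ℝ) (hle : ∀ n, ∀ᵐ x ∂μ, ‖g n x - g' x‖ ≤ C * ‖f n x - f' x‖)
    (hf : Tendsto (fun n => eLpNorm (fun x => f n x - f' x) 2 μ) atTop (𝓝 0)) :
    Tendsto (fun n => eLpNorm (fun x => g n x - g' x) 2 μ) atTop (𝓝 0) := by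
  have h0 : Tendsto (fun n => ENNReal.ofReal C * eLpNorm (fun x => f n x - f' x) 2 μ) atTop
      (𝓝 0) := by
    simpa using ENNReal.Tendsto.const_mul hf (Or.inr (ENNReal.ofReal_ne_top (r := C)))
  exact tendsto_of_tendsto_of_tendsto_of_le_of_le tendsto_const_nhds h0 (fun _ => zero_le)
    (fun n => eLpNorm_le_mul_eLpNorm_of_ae_le_mul (hle n) 2)

end L2Limits

/-! ### Polar coordinates and the Poincaré inequality on spheres. -/

theorem lintegral_polar (hN : 1 ≤ N) (x₀ : Euc N) {F : Euc N → ℝ≥0∞} (hF : Measurable F) :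
    ∫⁻ x, F x = ∫⁻ r in Ioi (0 : ℝ), ENNReal.ofReal (r ^ (N - 1)) *
      ∫⁻ ω, F (x₀ + r • (ω : Euc N)) ∂(volume : Measure (Euc N)).toSphere := by
  have : Nonempty (Fin N) := ⟨⟨0, hN⟩⟩
  have : Nontrivial (Euc N) := inferInstance
  have hmp := (volume : Measure (Euc N)).measurePreserving_homeomorphUnitSphereProd
  have hdim : Module.finrank ℝ (Euc N) = N := by simp [Euc]
  rw [hdim] at hmp
  calc ∫⁻ x, F x = ∫⁻ x, F (x₀ + x) := (lintegral_add_left_eq_self F x₀).symm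
    _ = ∫⁻ x in {(0 : Euc N)}ᶜ, F (x₀ + x) := by
        rw [restrict_compl_singleton]
    _ = ∫⁻ x : ({(0 : Euc N)}ᶜ : Set (Euc N)), F (x₀ + x) ∂(Measure.comap Subtype.val volume) := by
        rw [lintegral_subtype_comap (measurableSet_singleton _).compl (fun x => F (x₀ + x))]
    _ = ∫⁻ z : Metric.sphere (0 : Euc N) 1 × Ioi (0 : ℝ), F (x₀ + (z.2 : ℝ) • (z.1 : Euc N))
          ∂((volume : Measure (Euc N)).toSphere.prod (Measure.volumeIoiPow (N - 1))) := by
        rw [← hmp.lintegral_comp (f := fun z => F (x₀ + (z.2 : ℝ) • (z.1 : Euc N))) (by fun_prop)]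
        refine lintegral_congr fun x => ?_
        congr 2
        simp [smul_inv_smul₀ (norm_ne_zero_iff.2 x.2)]
    _ = ∫⁻ r : Ioi (0 : ℝ), ∫⁻ ω, F (x₀ + (r : ℝ) • (ω : Euc N))
          ∂(volume : Measure (Euc N)).toSphere ∂(Measure.volumeIoiPow (N - 1)) := by
        rw [lintegral_prod_symm _ (by fun_prop)]
    _ = _ := by
        rw [Measure.volumeIoiPow, lintegral_withDensity_eq_lintegral_mul _ (by fun_prop)]
        · exact lintegral_subtype_comap measurableSet_Ioi (fun r => ENNReal.ofReal (r ^ (N - 1)) *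
            ∫⁻ ω, F (x₀ + r • (ω : Euc N)) ∂(volume : Measure (Euc N)).toSphere)
        · exact Measurable.lintegral_prod_right' (f := fun z : Ioi (0 : ℝ) × Metric.sphere (0 : Euc N) 1 =>
            F (x₀ + (z.1 : ℝ) • (z.2 : Euc N))) (by fun_prop)

theorem lintegral_sphereSurface (x₀ : Euc N) (r : ℝ) {F : Euc N → ℝ≥0∞} (hF : Measurable F) :
    ∫⁻ x, F x ∂(sphereSurface x₀ r) = ENNReal.ofReal (r ^ ((N : ℝ) - 1)) *
      ∫⁻ ω, F (x₀ + r • (ω : Euc N)) ∂(volume : Measure (Euc N)).toSphere := by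
  rw [sphereSurface, lintegral_smul_measure, lintegral_map hF (by fun_prop), smul_eq_mul]

theorem continuous_gradient {φ : Euc N → ℝ} (hφ : ContDiff ℝ (⊤ : ℕ∞) φ) :
    Continuous (gradient φ) :=
  (InnerProductSpace.toDual ℝ (Euc N)).symm.continuous.comp (hφ.continuous_fderiv (by simp))

/-- Pythagoras for the radial and tangential parts. The right side does not divide by `r`, so it
makes sense as a quadratic form in `v` on the whole space. -/
theorem sq_mul_norm_sub_inner_smul_sq (v y : Euc N) {r : ℝ} (hr : 0 < r) (hy : ‖y‖ = r) :
    r ^ 2 * ‖v - inner ℝ v (r⁻¹ • y) • (r⁻¹ • y)‖ ^ 2 = ‖y‖ ^ 2 * ‖v‖ ^ 2 - (inner ℝ v y) ^ 2 := by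
  rw [norm_sub_sq_real, norm_smul, norm_smul, inner_smul_right, inner_smul_right, hy, norm_inv,
    Real.norm_eq_abs, Real.norm_eq_abs, abs_of_pos hr, inv_mul_cancel₀ hr.ne', mul_one, sq_abs]
  field_simp
  ring

section Poincare

variable {Ω : Opens (Euc N)} {x₀ : Euc N} {r₀ σ : ℝ}

/-- A test function on `Ω` restricts to an admissible competitor on every sphere at once, so no
traces of Sobolev functions are needed. -/
theorem sphere_poincare
    (hσ : ENNReal.ofReal σ ≤
      (⨅ r ∈ Ioo (0 : ℝ) r₀, ENNReal.ofReal (r ^ 2) * sphericalEigenvalue Ω x₀ r))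
    (φ : 𝓓(Ω, ℝ)) {r : ℝ} (hr : r ∈ Ioo 0 r₀) :
    ENNReal.ofReal σ * ∫⁻ x, ENNReal.ofReal (φ x ^ 2) ∂(sphereSurface x₀ r) ≤
      ENNReal.ofReal (r ^ 2) *
        ∫⁻ x, ENNReal.ofReal (‖tangentialGradient x₀ r φ x‖ ^ 2) ∂(sphereSurface x₀ r) := by
  by_cases h0 : ∫⁻ x, ENNReal.ofReal (φ x ^ 2) ∂(sphereSurface x₀ r) = 0
  · simp [h0]
  have htop : ∫⁻ x, ENNReal.ofReal (φ x ^ 2) ∂(sphereSurface x₀ r) ≠ ⊤ := by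
    rw [lintegral_sphereSurface _ _ (by fun_prop)]
    refine ENNReal.mul_ne_top ENNReal.ofReal_ne_top ?_
    obtain ⟨C, hC⟩ := φ.hasCompactSupport.exists_bound_of_continuous φ.continuous
    refine ne_top_of_le_ne_top ?_ (lintegral_mono (g := fun _ => ENNReal.ofReal (C ^ 2)) ?_)
    · rw [lintegral_const]
      exact ENNReal.mul_ne_top ENNReal.ofReal_ne_top (measure_ne_top _ _)
    · intro ω
      refine ENNReal.ofReal_le_ofReal ?_
      rw [← sq_abs, ← Real.norm_eq_abs]
      exact pow_le_pow_left₀ (norm_nonneg _) (hC _) 2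
  have h1 : IsSphericalTest Ω x₀ r φ :=
    ⟨φ.contDiff, (closure_mono inter_subset_left).trans φ.tsupport_subset⟩
  have h2 := (hσ.trans (iInf₂_le r hr)).trans
    (mul_le_mul_right ((iInf_le _ (φ : Euc N → ℝ)).trans ((iInf_le _ h1).trans (iInf_le _ h0))) _)
  rw [← mul_div_assoc] at h2
  exact (ENNReal.le_div_iff_mul_le (Or.inl h0) (Or.inl htop)).1 h2

/-- The inequalities on single spheres are integrated in `r` against the radial weight `k`, which
must vanish where the eigenvalue bound is not assumed. -/
theorem weighted_poincare (hN : 1 ≤ N)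
    (hσ : ENNReal.ofReal σ ≤
      (⨅ r ∈ Ioo (0 : ℝ) r₀, ENNReal.ofReal (r ^ 2) * sphericalEigenvalue Ω x₀ r))
    (φ : 𝓓(Ω, ℝ)) {k : ℝ → ℝ≥0∞} (hk : Measurable k) (hk0 : ∀ r, r ∉ Ioo 0 r₀ → k r = 0) :
    ENNReal.ofReal σ * ∫⁻ x, k ‖x - x₀‖ * ENNReal.ofReal (φ x ^ 2) ≤
      ∫⁻ x, k ‖x - x₀‖ * ENNReal.ofReal
        (‖x - x₀‖ ^ 2 * ‖gradient φ x‖ ^ 2 - (inner ℝ (gradient φ x) (x - x₀)) ^ 2) := by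
  have hg := continuous_gradient φ.contDiff
  have hgm := hg.measurable
  rw [lintegral_polar hN x₀ (by fun_prop), lintegral_polar hN x₀ (by fun_prop),
    ← lintegral_const_mul' _ _ ENNReal.ofReal_ne_top]
  refine setLIntegral_mono' measurableSet_Ioi fun r hr => ?_
  have hr : 0 < r := hr
  have hnorm : ∀ ω : Metric.sphere (0 : Euc N) 1, ‖r • (ω : Euc N)‖ = r := by
    intro ω
    rw [norm_smul, norm_eq_of_mem_sphere, mul_one, Real.norm_eq_abs, abs_of_pos hr]
  by_cases hr0 : r ∈ Ioo 0 r₀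
  swap
  · simp [hnorm, hk0 r hr0]
  have h1 := sphere_poincare hσ φ hr0
  have htm : Measurable (fun x => ENNReal.ofReal (‖tangentialGradient x₀ r φ x‖ ^ 2)) := by
    unfold tangentialGradient
    fun_prop
  rw [lintegral_sphereSurface _ _ (by fun_prop), lintegral_sphereSurface _ _ htm,
    mul_left_comm, mul_left_comm (ENNReal.ofReal (r ^ 2))] at h1
  have hpos : 0 < r ^ ((N : ℝ) - 1) := Real.rpow_pos_of_pos hr _
  have h2 := (ENNReal.mul_le_mul_iff_right (by simpa using hpos) ENNReal.ofReal_ne_top).1 h1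
  rw [← lintegral_const_mul' (ENNReal.ofReal (r ^ 2)) _ ENNReal.ofReal_ne_top] at h2
  have h3 : ∀ ω : Metric.sphere (0 : Euc N) 1,
      ENNReal.ofReal (r ^ 2) *
        ENNReal.ofReal (‖tangentialGradient x₀ r φ (x₀ + r • (ω : Euc N))‖ ^ 2) =
      ENNReal.ofReal (r ^ 2 * ‖gradient φ (x₀ + r • (ω : Euc N))‖ ^ 2 -
        (inner ℝ (gradient φ (x₀ + r • (ω : Euc N))) (r • (ω : Euc N))) ^ 2) := by
    intro ω
    rw [← ENNReal.ofReal_mul (sq_nonneg r), tangentialGradient, add_sub_cancel_left,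
      sq_mul_norm_sub_inner_smul_sq _ _ hr (hnorm ω), hnorm]
  simp only [h3] at h2
  simp only [add_sub_cancel_left, hnorm]
  rw [lintegral_const_mul _ (by fun_prop), lintegral_const_mul _ (by fun_prop),
    mul_left_comm, mul_left_comm (ENNReal.ofReal σ)]
  gcongr

end Poincare

/-! ### Radial identities and inequalities for test functions, and their extension to W₀^{1,2}. -/

theorem tendsto_integral_inner_clm {E F : Type*} [NormedAddCommGroup E] [NormedAddCommGroup F]
    [NormedSpace ℝ E] [InnerProductSpace ℝ F] {μ : Measure (Euc N)}
    {A : Euc N → E →L[ℝ] F} (hA : Continuous A) (hAc : HasCompactSupport A)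
    {f : ℕ → Euc N → E} {g : ℕ → Euc N → F} {f' : Euc N → E} {g' : Euc N → F}
    (hf : ∀ n, MemLp (f n) 2 μ) (hg : ∀ n, MemLp (g n) 2 μ)
    (hf' : MemLp f' 2 μ) (hg' : MemLp g' 2 μ)
    (hff : Tendsto (fun n => eLpNorm (fun x => f n x - f' x) 2 μ) atTop (𝓝 0))
    (hgg : Tendsto (fun n => eLpNorm (fun x => g n x - g' x) 2 μ) atTop (𝓝 0)) :
    Tendsto (fun n => ∫ x, inner ℝ (A x (f n x)) (g n x) ∂μ) atTop
      (𝓝 (∫ x, inner ℝ (A x (f' x)) (g' x) ∂μ)) := by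
  obtain ⟨C, hC⟩ := hAc.exists_bound_of_continuous hA
  have hle : ∀ x v, ‖A x v‖ ≤ C * ‖v‖ := fun x v => (A x).le_of_opNorm_le (hC x) v
  have hmem : ∀ {h : Euc N → E}, MemLp h 2 μ → MemLp (fun x => A x (h x)) 2 μ := fun hh =>
    hh.of_le_mul (isBoundedBilinearMap_apply.continuous.comp_aestronglyMeasurable
      (hA.aestronglyMeasurable.prodMk hh.aestronglyMeasurable)) (ae_of_all _ fun x => hle x _)
  refine tendsto_integral_inner (fun n => hmem (hf n)) hg (hmem hf') hg' ?_ hgg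
  refine tendsto_eLpNorm_sub_of_le C (fun n => ae_of_all _ fun x => ?_) hff
  rw [← map_sub]
  exact hle x _

/-- Divergence theorem for the field `f x • (x - x₀)`, whose divergence is `N f + ∇f · (x - x₀)`; it
is proved coordinate by coordinate. -/
theorem integral_fderiv_apply_sub (x₀ : Euc N) {f : Euc N → ℝ} (hf : ContDiff ℝ 1 f)
    (hc : HasCompactSupport f) :
    ∫ x, fderiv ℝ f x (x - x₀) = - ((N : ℝ) * ∫ x, f x) := by
  have hfd := hf.continuous_fderiv (by simp)
  have hcd : HasCompactSupport (fderiv ℝ f) := hc.fderiv ℝ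
  have hint : ∀ i : Fin N, Integrable
      (fun x => fderiv ℝ f x (EuclideanSpace.single i 1) * (x - x₀) i) := fun i =>
    Continuous.integrable_of_hasCompactSupport (by fun_prop)
      (hcd.mono' (fun x hx => subset_closure fun h0 => hx (by simp [h0])))
  have hi : ∀ i : Fin N, ∫ x, fderiv ℝ f x (EuclideanSpace.single i 1) * (x - x₀) i =
      - ∫ x, f x := by
    intro i
    have hd : ∀ x, HasFDerivAt (fun x : Euc N => (x - x₀) i)
        (EuclideanSpace.proj i : Euc N →L[ℝ] ℝ) x := fun x =>
      (EuclideanSpace.proj i : Euc N →L[ℝ] ℝ).hasFDerivAt.comp (f := fun x => x - x₀) x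
        ((hasFDerivAt_id x).sub_const x₀)
    have h1i : (EuclideanSpace.proj i : Euc N →L[ℝ] ℝ) (EuclideanSpace.single i 1) = 1 := by simp
    have hfi : Integrable f := hf.continuous.integrable_of_hasCompactSupport hc
    have h1 := integral_mul_fderiv_eq_neg_fderiv_mul_of_integrable (μ := volume) (f := f)
      (g := fun x : Euc N => (x - x₀) i) (v := EuclideanSpace.single i 1) (hint i)
      (by simpa only [(hd _).fderiv, h1i, mul_one] using hfi)
      (Continuous.integrable_of_hasCompactSupport (by fun_prop) hc.mul_right)
      (fun x _ => hf.differentiable (by simp) x) (fun x _ => (hd x).differentiableAt)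
    simp only [(hd _).fderiv, h1i, mul_one] at h1
    rw [h1, neg_neg]
  have hsum : ∀ x : Euc N, fderiv ℝ f x (x - x₀) =
      ∑ i, fderiv ℝ f x (EuclideanSpace.single i 1) * (x - x₀) i := by
    intro x
    conv_lhs => rw [← (EuclideanSpace.basisFun (Fin N) ℝ).sum_repr (x - x₀)]
    simp [mul_comm]
  simp only [hsum]
  rw [integral_finsetSum _ (fun i _ => hint i)]
  rw [Finset.sum_congr rfl fun i _ => hi i]
  simp

theorem hasGradientAt_comp_normSq {g : ℝ → ℝ} {x₀ x : Euc N} {g' : ℝ}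
    (hg : HasDerivAt g g' (‖x - x₀‖ ^ 2)) :
    HasGradientAt (fun x => g (‖x - x₀‖ ^ 2)) ((2 * g') • (x - x₀)) x := by
  have h1 : HasFDerivAt (fun x : Euc N => ‖x - x₀‖ ^ 2) (2 • innerSL ℝ (x - x₀)) x := by
    exact (hasStrictFDerivAt_norm_sq (x - x₀)).hasFDerivAt.comp (f := fun x => x - x₀) x
      ((hasFDerivAt_id x).sub_const x₀)
  rw [hasGradientAt_iff_hasFDerivAt]
  refine (hg.comp_hasFDerivAt x h1).congr_fderiv ?_
  ext v
  simp
  ring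

theorem hasCompactSupport_comp_normSq {F : Type*} [Zero F] {A : Euc N → F} (x₀ : Euc N) {R : ℝ}
    (hA : ∀ x, R ≤ ‖x - x₀‖ ^ 2 → A x = 0) : HasCompactSupport A := by
  refine HasCompactSupport.of_support_subset_isCompact (isCompact_closedBall x₀ (√R)) ?_
  intro x hx
  rw [Metric.mem_closedBall, dist_eq_norm]
  by_contra h
  exact hx (hA x ((Real.sqrt_lt' ((Real.sqrt_nonneg R).trans_lt (not_le.1 h))).1 (not_le.1 h)).le)

theorem gradient_eq_zero_of_notMem {Ω : Opens (Euc N)} (φ : 𝓓(Ω, ℝ)) {x : Euc N} (hx : x ∉ Ω) :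
    gradient φ x = 0 := by
  have : fderiv ℝ φ x = 0 := by
    by_contra h
    exact hx (φ.tsupport_subset (support_fderiv_subset ℝ h))
  rw [gradient, this, map_zero]

theorem testFunction_eq_zero_of_notMem {Ω : Opens (Euc N)} (φ : 𝓓(Ω, ℝ)) {x : Euc N}
    (hx : x ∉ Ω) : φ x = 0 :=
  image_eq_zero_of_notMem_tsupport fun h => hx (φ.tsupport_subset h)

theorem hasCompactSupport_gradient {Ω : Opens (Euc N)} (φ : 𝓓(Ω, ℝ)) :
    HasCompactSupport (gradient φ) :=
  (φ.hasCompactSupport.fderiv ℝ).comp_left (g := (InnerProductSpace.toDual ℝ (Euc N)).symm)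
    (map_zero _)

/-- The previous divergence identity applied to `g φ²`. -/
theorem integral_sq_mul_add_fderiv (Ω : Opens (Euc N)) (x₀ : Euc N) (φ : 𝓓(Ω, ℝ))
    {g : Euc N → ℝ} (hg : ContDiff ℝ 1 g) :
    ∫ x in Ω, ((N : ℝ) * g x + fderiv ℝ g x (x - x₀)) * φ x ^ 2 =
      - ∫ x in Ω, 2 * g x * φ x * inner ℝ (gradient φ x) (x - x₀) := by
  have hφ : ContDiff ℝ 1 φ := φ.contDiff.of_le (by simp)
  have hgc := hg.continuous
  have hdg := hg.continuous_fderiv (by simp)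
  have hgrad := continuous_gradient φ.contDiff
  have hc : ∀ {a : Euc N → ℝ}, HasCompactSupport fun x => a x * φ x := fun {a} =>
    φ.hasCompactSupport.mul_left (f := a)
  have h1 := integral_fderiv_apply_sub x₀ (f := fun x => (φ x * g x) * φ x)
    ((hφ.mul hg).mul hφ) hc
  have hder : ∀ x, fderiv ℝ (fun x => (φ x * g x) * φ x) x (x - x₀) =
      2 * g x * φ x * inner ℝ (gradient φ x) (x - x₀) + fderiv ℝ g x (x - x₀) * φ x ^ 2 := by
    intro x
    have hd : HasFDerivAt φ (fderiv ℝ φ x) x := (hφ.differentiable (by simp) x).hasFDerivAt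
    have hd2 : HasFDerivAt g (fderiv ℝ g x) x := (hg.differentiable (by simp) x).hasFDerivAt
    rw [((hd.fun_mul hd2).fun_mul hd).fderiv]
    simp only [add_apply, smul_apply, inner_gradient_left, smul_eq_mul]
    ring
  simp only [hder] at h1
  have i1 : Integrable (fun x => 2 * g x * φ x * inner ℝ (gradient φ x) (x - x₀)) :=
    Continuous.integrable_of_hasCompactSupport (by fun_prop) hc.mul_right
  have i2 : Integrable (fun x => fderiv ℝ g x (x - x₀) * φ x ^ 2) := by
    refine Continuous.integrable_of_hasCompactSupport (by fun_prop) ?_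
    simp only [pow_two (φ _), ← mul_assoc]
    exact hc
  have i3 : Integrable (fun x => (N : ℝ) * g x * φ x ^ 2) := by
    refine Continuous.integrable_of_hasCompactSupport (by fun_prop) ?_
    simp only [pow_two (φ _), ← mul_assoc]
    exact hc
  rw [integral_add i1 i2, ← integral_const_mul] at h1
  rw [setIntegral_eq_integral_of_forall_compl_eq_zero
      (fun x hx => by simp [testFunction_eq_zero_of_notMem φ hx]),
    setIntegral_eq_integral_of_forall_compl_eq_zero
      (fun x hx => by simp [testFunction_eq_zero_of_notMem φ hx])]
  simp only [add_mul]
  rw [integral_add i3 i2]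
  have h3 : ∀ x, (N : ℝ) * (φ x * g x * φ x) = N * g x * φ x ^ 2 := fun x => by ring
  simp only [h3] at h1
  linarith

theorem testFunction_poincare {Ω : Opens (Euc N)} {x₀ : Euc N} {r₀ σ : ℝ} (hN : 1 ≤ N) (hσ0 : 0 ≤ σ)
    (hr₀ : 0 < r₀)
    (hσ : ENNReal.ofReal σ ≤
      (⨅ r ∈ Ioo (0 : ℝ) r₀, ENNReal.ofReal (r ^ 2) * sphericalEigenvalue Ω x₀ r))
    (φ : 𝓓(Ω, ℝ)) {κ : ℝ → ℝ} (hκ : Continuous κ) (hκ0 : ∀ t, 0 ≤ κ t)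
    (hκs : ∀ t, t ∉ Ioo 0 (r₀ ^ 2) → κ t = 0) :
    σ * ∫ x in Ω, κ (‖x - x₀‖ ^ 2) * φ x ^ 2 ≤
      ∫ x in Ω, κ (‖x - x₀‖ ^ 2) *
        (‖x - x₀‖ ^ 2 * ‖gradient φ x‖ ^ 2 - (inner ℝ (gradient φ x) (x - x₀)) ^ 2) := by
  have h1 := weighted_poincare hN hσ φ (k := fun r => if r ∈ Ioo 0 r₀ then
    ENNReal.ofReal (κ (r ^ 2)) else 0)
    (Measurable.ite measurableSet_Ioo (by fun_prop) measurable_const)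
    (fun r hr => if_neg hr)
  have hk : ∀ x : Euc N, (if ‖x - x₀‖ ∈ Ioo 0 r₀ then ENNReal.ofReal (κ (‖x - x₀‖ ^ 2)) else 0) =
      ENNReal.ofReal (κ (‖x - x₀‖ ^ 2)) := by
    intro x
    split_ifs with h
    · rfl
    · rw [hκs, ENNReal.ofReal_zero]
      intro h2
      refine h ⟨?_, lt_of_pow_lt_pow_left₀ 2 hr₀.le h2.2⟩
      by_contra h3
      have : ‖x - x₀‖ = 0 := le_antisymm (not_lt.1 h3) (norm_nonneg _)
      simp [this] at h2
  simp only [hk, ← ENNReal.ofReal_mul (hκ0 _)] at h1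
  have hgrad := continuous_gradient φ.contDiff
  have hgc := hasCompactSupport_gradient φ
  have hnn : ∀ x, 0 ≤ κ (‖x - x₀‖ ^ 2) *
        (‖x - x₀‖ ^ 2 * ‖gradient φ x‖ ^ 2 - (inner ℝ (gradient φ x) (x - x₀)) ^ 2) := by
    intro x
    refine mul_nonneg (hκ0 _) (sub_nonneg.2 ?_)
    rw [← mul_pow, mul_comm, ← sq_abs]
    exact pow_le_pow_left₀ (abs_nonneg _) (abs_real_inner_le_norm _ _) 2
  rw [← ofReal_integral_eq_lintegral_ofReal _ (ae_of_all _ fun x => mul_nonneg (hκ0 _)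
      (sq_nonneg _)), ← ofReal_integral_eq_lintegral_ofReal _ (ae_of_all _ hnn),
      ← ENNReal.ofReal_mul hσ0, ENNReal.ofReal_le_ofReal_iff (integral_nonneg hnn)] at h1
  · rwa [setIntegral_eq_integral_of_forall_compl_eq_zero
      (fun x hx => by simp [testFunction_eq_zero_of_notMem φ hx]),
      setIntegral_eq_integral_of_forall_compl_eq_zero
      (fun x hx => by simp [gradient_eq_zero_of_notMem φ hx])]
  · exact Continuous.integrable_of_hasCompactSupport (by fun_prop)
      (hgc.mono' fun x hx => subset_closure fun h0 => hx (by simp [h0]))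
  · exact Continuous.integrable_of_hasCompactSupport (by fun_prop)
      (φ.hasCompactSupport.mono' fun x hx => subset_closure fun h0 => hx (by simp [h0]))

theorem memLp_testFunction {Ω : Opens (Euc N)} (φ : 𝓓(Ω, ℝ)) (μ : Measure (Euc N))
    [IsFiniteMeasureOnCompacts μ] : MemLp φ 2 μ :=
  φ.continuous.memLp_of_hasCompactSupport φ.hasCompactSupport

theorem memLp_gradient_testFunction {Ω : Opens (Euc N)} (φ : 𝓓(Ω, ℝ)) (μ : Measure (Euc N))
    [IsFiniteMeasureOnCompacts μ] : MemLp (gradient φ) 2 μ :=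
  (continuous_gradient φ.contDiff).memLp_of_hasCompactSupport (hasCompactSupport_gradient φ)

section Limits

variable {Ω : Opens (Euc N)} {u : Euc N → ℝ} {G : Euc N → Euc N} {x₀ : Euc N}

/-- Both sides are bounded quadratic forms, in `u` and in `G`, so the inequality passes to the L²
limit of the approximating test functions. -/
theorem MemW012.poincare {r₀ σ : ℝ} (hu : MemW012 Ω u G) (hN : 1 ≤ N) (hσ0 : 0 ≤ σ)
    (hr₀ : 0 < r₀)
    (hσ : ENNReal.ofReal σ ≤
      (⨅ r ∈ Ioo (0 : ℝ) r₀, ENNReal.ofReal (r ^ 2) * sphericalEigenvalue Ω x₀ r))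
    {κ : ℝ → ℝ} (hκ : Continuous κ) (hκ0 : ∀ t, 0 ≤ κ t)
    (hκs : ∀ t, t ∉ Ioo 0 (r₀ ^ 2) → κ t = 0) :
    σ * ∫ x in Ω, κ (‖x - x₀‖ ^ 2) * u x ^ 2 ≤
      ∫ x in Ω, κ (‖x - x₀‖ ^ 2) *
        (‖x - x₀‖ ^ 2 * ‖G x‖ ^ 2 - (inner ℝ (G x) (x - x₀)) ^ 2) := by
  obtain ⟨φ, h1, h2⟩ := hu.exists_approx
  have hz : ∀ x, r₀ ^ 2 ≤ ‖x - x₀‖ ^ 2 → κ (‖x - x₀‖ ^ 2) = 0 := fun x hx =>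
    hκs _ fun h => absurd h.2 (not_lt.2 hx)
  have l1 := tendsto_integral_inner_clm (μ := volume.restrict Ω)
    (A := fun x => κ (‖x - x₀‖ ^ 2) • ContinuousLinearMap.id ℝ ℝ) (by fun_prop)
    (hasCompactSupport_comp_normSq x₀ (R := r₀ ^ 2) fun x hx => by simp [hz x hx])
    (fun n => memLp_testFunction (φ n) _) (fun n => memLp_testFunction (φ n) _)
    hu.memLp hu.memLp h1 h1
  -- The form |y|²|V|² - (V·y)² is given by the matrix |y|² I - y ⊗ y, with y = x - x₀.
  have l2 := tendsto_integral_inner_clm (μ := volume.restrict Ω)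
    (A := fun x => κ (‖x - x₀‖ ^ 2) • (‖x - x₀‖ ^ 2 • ContinuousLinearMap.id ℝ (Euc N) -
      (innerSL ℝ (x - x₀)).smulRight (x - x₀))) (by fun_prop)
    (hasCompactSupport_comp_normSq x₀ (R := r₀ ^ 2) fun x hx => by simp [hz x hx])
    (fun n => memLp_gradient_testFunction (φ n) _) (fun n => memLp_gradient_testFunction (φ n) _)
    hu.memLp_grad hu.memLp_grad h2 h2
  have e1 : ∀ (v : Euc N → ℝ) (x : Euc N), inner ℝ ((κ (‖x - x₀‖ ^ 2) •
      ContinuousLinearMap.id ℝ ℝ) (v x)) (v x) = κ (‖x - x₀‖ ^ 2) * v x ^ 2 := by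
    intro v x
    simp
    ring
  have e2 : ∀ (V : Euc N → Euc N) (x : Euc N), inner ℝ ((κ (‖x - x₀‖ ^ 2) •
      (‖x - x₀‖ ^ 2 • ContinuousLinearMap.id ℝ (Euc N) -
      (innerSL ℝ (x - x₀)).smulRight (x - x₀))) (V x)) (V x) = κ (‖x - x₀‖ ^ 2) *
        (‖x - x₀‖ ^ 2 * ‖V x‖ ^ 2 - (inner ℝ (V x) (x - x₀)) ^ 2) := by
    intro V x
    have h3 : inner ℝ (x - x₀) (V x) = inner ℝ (V x) (x - x₀) := real_inner_comm _ _
    simp only [smul_apply, sub_apply,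
      ContinuousLinearMap.id_apply, ContinuousLinearMap.smulRight_apply, innerSL_apply_apply,
      inner_smul_left, inner_sub_left, real_inner_self_eq_norm_sq, h3]
    simp
    left
    ring
  simp only [e1] at l1
  simp only [e2] at l2
  exact le_of_tendsto_of_tendsto' (l1.const_mul σ) l2 fun n =>
    testFunction_poincare hN hσ0 hr₀ hσ (φ n) hκ hκ0 hκs

theorem MemW012.integral_sq_mul_add_fderiv (hu : MemW012 Ω u G) {g : Euc N → ℝ}
    (hg : ContDiff ℝ 1 g) (hgs : HasCompactSupport g) :
    ∫ x in Ω, ((N : ℝ) * g x + fderiv ℝ g x (x - x₀)) * u x ^ 2 =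
      - ∫ x in Ω, 2 * g x * u x * inner ℝ (G x) (x - x₀) := by
  obtain ⟨φ, h1, h2⟩ := hu.exists_approx
  have hgc := hg.continuous
  have hdg := hg.continuous_fderiv (by simp)
  have hφ := fun n => ACF.integral_sq_mul_add_fderiv Ω x₀ (φ n) hg
  have hcR : HasCompactSupport fun x => (N : ℝ) * g x + fderiv ℝ g x (x - x₀) :=
    hgs.mul_left.add ((hgs.fderiv ℝ).mono' fun x hx => subset_closure fun h0 => hx (by simp [h0]))
  have hcc : Continuous fun x => (N : ℝ) * g x + fderiv ℝ g x (x - x₀) := by fun_prop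
  obtain ⟨c, hc⟩ : ∃ c : Euc N → ℝ, c = fun x => (N : ℝ) * g x + fderiv ℝ g x (x - x₀) := ⟨_, rfl⟩
  have hc' : ∀ x, (N : ℝ) * g x + fderiv ℝ g x (x - x₀) = c x := fun x => by rw [hc]
  simp only [hc'] at hφ hcR hcc ⊢
  have l1 := tendsto_integral_inner_clm (μ := volume.restrict Ω)
    (A := fun x => c x • ContinuousLinearMap.id ℝ ℝ) (by fun_prop)
    (hcR.mono' fun x hx => subset_closure fun h0 => hx (by simp [h0]))
    (fun n => memLp_testFunction (φ n) _) (fun n => memLp_testFunction (φ n) _)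
    hu.memLp hu.memLp h1 h1
  have l2 := tendsto_integral_inner_clm (μ := volume.restrict Ω)
    (A := fun x => (2 * g x) • innerSL ℝ (x - x₀)) (by fun_prop)
    (hgs.mono' fun x hx => subset_closure fun h0 => hx (by simp [h0]))
    (fun n => memLp_gradient_testFunction (φ n) _) (fun n => memLp_testFunction (φ n) _)
    hu.memLp_grad hu.memLp h2 h1
  have e1 : ∀ (v : Euc N → ℝ) (x : Euc N), inner ℝ ((c x •
      ContinuousLinearMap.id ℝ ℝ) (v x)) (v x) = c x * v x ^ 2 := by
    intro v x
    simp
    ring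
  have e2 : ∀ (v : Euc N → ℝ) (V : Euc N → Euc N) (x : Euc N), inner ℝ
      (((2 * g x) • innerSL ℝ (x - x₀)) (V x)) (v x) = 2 * g x * v x * inner ℝ (V x) (x - x₀) := by
    intro v V x
    simp only [smul_apply, innerSL_apply_apply, real_inner_comm]
    simp
    ring
  simp only [e1] at l1
  simp only [e2] at l2
  exact tendsto_nhds_unique l1 (l2.neg.congr fun n => (hφ n).symm)

end Limits

/-! ### The energy identity: testing the equation with u η. -/

theorem abs_le_abs_of_abs_deriv_le_one {T : ℝ → ℝ} (hT : Differentiable ℝ T) (hT0 : T 0 = 0)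
    (hT' : ∀ s, |deriv T s| ≤ 1) (s : ℝ) : |T s| ≤ |s| := by
  have := convex_univ.norm_image_sub_le_of_norm_deriv_le (f := T) (C := 1) (x := 0) (y := s)
    (fun x _ => hT x) (fun x _ => hT' x) (mem_univ _) (mem_univ _)
  simpa [hT0] using this

theorem hasGradientAt_comp_mul {T : ℝ → ℝ} {φ η : Euc N → ℝ} (hT : Differentiable ℝ T)
    (hφ : Differentiable ℝ φ) (hη : Differentiable ℝ η) (x : Euc N) :
    HasGradientAt (fun x => T (φ x) * η x)
      ((deriv T (φ x) * η x) • gradient φ x + T (φ x) • gradient η x) x := by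
  rw [hasGradientAt_iff_hasFDerivAt]
  refine (((hT (φ x)).hasDerivAt.comp_hasFDerivAt x (hφ x).hasFDerivAt).fun_mul
    (hη x).hasFDerivAt).congr_fderiv ?_
  ext v
  simp only [add_apply, smul_apply, InnerProductSpace.toDual_apply_apply, inner_add_left,
    inner_smul_left, inner_gradient_left, smul_eq_mul, conj_trivial, Function.comp_apply]
  ring

section EnergyIdentity

variable {Ω : Opens (Euc N)} {f u : Euc N → ℝ} {G : Euc N → Euc N} {η : Euc N → ℝ} {T : ℝ → ℝ}

theorem IsWeakSolution.weak_eq_comp_mul (hu : IsWeakSolution Ω f u G)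
    (hη : ContDiff ℝ (⊤ : ℕ∞) η) (hT : ContDiff ℝ (⊤ : ℕ∞) T) (hT0 : T 0 = 0) (φ : 𝓓(Ω, ℝ)) :
    ∫ x in Ω, (deriv T (φ x) * η x * inner ℝ (G x) (gradient φ x) +
      T (φ x) * inner ℝ (G x) (gradient η x)) = ∫ x in Ω, f x * (T (φ x) * η x) := by
  have hc : HasCompactSupport fun x => T (φ x) := φ.hasCompactSupport.comp_left (g := T) hT0
  have hs : tsupport (fun x => T (φ x) * η x) ⊆ Ω := by
    refine (closure_mono fun x hx => ?_).trans φ.tsupport_subset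
    intro h0
    exact hx (by simp [h0, hT0])
  have h := hu.weak_eq ⟨fun x => T (φ x) * η x, (hT.comp φ.contDiff).mul hη, hc.mul_right, hs⟩
  have hg : ∀ x, gradient (fun x => T (φ x) * η x) x =
      (deriv T (φ x) * η x) • gradient φ x + T (φ x) • gradient η x := fun x =>
    (hasGradientAt_comp_mul (hT.differentiable (by simp)) (φ.contDiff.differentiable (by simp))
      (hη.differentiable (by simp)) x).gradient
  simp only [TestFunction.coe_mk, hg, inner_add_right, inner_smul_right] at h
  exact h

/-- For `f` merely integrable, L² convergence of the approximants does not control the source term.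
With `T` bounded it does: an a.e. convergent subsequence and dominated convergence suffice. -/
theorem IsWeakSolution.truncated_identity (hu : IsWeakSolution Ω f u G)
    (hf : IntegrableOn f Ω) (hη : ContDiff ℝ (⊤ : ℕ∞) η) (hηc : HasCompactSupport η)
    (hT : ContDiff ℝ (⊤ : ℕ∞) T) (hT0 : T 0 = 0) {M : ℝ} (hTM : ∀ s, |T s| ≤ M)
    (hT' : ∀ s, |deriv T s| ≤ 1) :
    (∫ x in Ω, deriv T (u x) * η x * ‖G x‖ ^ 2) + ∫ x in Ω, T (u x) * inner ℝ (G x) (gradient η x) =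
      ∫ x in Ω, f x * (T (u x) * η x) := by
  obtain ⟨φ₀, h1, h2⟩ := hu.exists_approx
  obtain ⟨ns, hns, hae⟩ := (tendstoInMeasure_of_tendsto_eLpNorm (two_ne_zero)
    (fun n => (memLp_testFunction (φ₀ n) _).aestronglyMeasurable)
    hu.memLp.aestronglyMeasurable h1).exists_seq_tendsto_ae
  obtain ⟨φ, hφ⟩ : ∃ φ : ℕ → 𝓓(Ω, ℝ), φ = fun n => φ₀ (ns n) := ⟨_, rfl⟩
  replace h2 : Tendsto (fun n => eLpNorm (fun x => gradient (φ n) x - G x) 2 (volume.restrict Ω))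
      atTop (𝓝 0) := by
    rw [hφ]
    exact h2.comp hns.tendsto_atTop
  replace hae : ∀ᵐ x ∂(volume.restrict (Ω : Set (Euc N))),
      Tendsto (fun n => φ n x) atTop (𝓝 (u x)) := by
    rw [hφ]
    exact hae
  obtain ⟨C, hC⟩ := hηc.exists_bound_of_continuous hη.continuous
  have hηg := continuous_gradient hη
  have hηgc : HasCompactSupport (gradient η) :=
    (hηc.fderiv ℝ).comp_left (g := (InnerProductSpace.toDual ℝ (Euc N)).symm) (map_zero _)
  have hTc := hT.continuous
  have hdT : Continuous (deriv T) := hT.continuous_deriv (by simp)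
  have hηcont := hη.continuous
  have hum := hu.memLp.aestronglyMeasurable
  have hGm := hu.memLp_grad.aestronglyMeasurable
  have hTm : ∀ {v : Euc N → ℝ}, AEStronglyMeasurable v (volume.restrict Ω) →
      AEStronglyMeasurable (fun x => deriv T (v x) * η x) (volume.restrict Ω) := fun hv =>
    (hdT.comp_aestronglyMeasurable hv).mul hηcont.aestronglyMeasurable
  have hφm : ∀ n, AEStronglyMeasurable (φ n) (volume.restrict (Ω : Set (Euc N))) := fun n =>
    (φ n).continuous.aestronglyMeasurable
  have hgm : ∀ n, AEStronglyMeasurable (gradient (φ n)) (volume.restrict (Ω : Set (Euc N))) :=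
    fun n => (continuous_gradient (φ n).contDiff).aestronglyMeasurable
  have hbd : ∀ s x, |deriv T s * η x| ≤ C := by
    intro s x
    rw [abs_mul]
    calc _ ≤ 1 * C := mul_le_mul (hT' s) (hC x) (abs_nonneg _) zero_le_one
      _ = C := one_mul C
  have hC0 : 0 ≤ C := (abs_nonneg _).trans (hbd 0 0)
  have hM0 : 0 ≤ M := (abs_nonneg _).trans (hTM 0)
  have hG2 : IntegrableOn (fun x => ‖G x‖ ^ 2) Ω := hu.memLp_grad.norm.integrable_sq
  have hG1 : IntegrableOn (fun x => ‖G x‖ * ‖gradient η x‖) Ω :=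
    hu.memLp_grad.norm.integrable_mul (hηg.memLp_of_hasCompactSupport hηgc (p := 2)).norm
  have i1 : ∀ n, IntegrableOn
      (fun x => deriv T (φ n x) * η x * inner ℝ (G x) (gradient (φ n) x - G x)) Ω := by
    intro n
    have hd : MemLp (fun x => gradient (φ n) x - G x) 2 (volume.restrict Ω) :=
      (memLp_gradient_testFunction (φ n) _).sub hu.memLp_grad
    refine ((hu.memLp_grad.norm.integrable_mul hd.norm).const_mul C).mono'
      ((hTm (hφm n)).mul (hGm.inner ((hgm n).sub hGm))) (ae_of_all _ fun x => ?_)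
    rw [norm_mul]
    exact mul_le_mul (hbd _ _) (norm_inner_le_norm _ _) (norm_nonneg _) hC0
  have i2 : ∀ n, IntegrableOn (fun x => deriv T (φ n x) * η x * ‖G x‖ ^ 2) Ω := by
    intro n
    refine (hG2.const_mul C).mono' ((hTm (hφm n)).mul (hGm.norm.pow 2)) (ae_of_all _ fun x => ?_)
    rw [norm_mul, norm_pow, norm_norm]
    exact mul_le_mul_of_nonneg_right (hbd _ _) (sq_nonneg _)
  have i3 : ∀ n, IntegrableOn (fun x => T (φ n x) * inner ℝ (G x) (gradient η x)) Ω := by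
    intro n
    refine (hG1.const_mul M).mono' ((hTc.comp_aestronglyMeasurable (hφm n)).mul
      (hGm.inner hηg.aestronglyMeasurable)) (ae_of_all _ fun x => ?_)
    rw [norm_mul]
    exact mul_le_mul (hTM _) (norm_inner_le_norm _ _) (norm_nonneg _) hM0
  -- Here ∇φₙ is split as G + (∇φₙ - G): the first part has a fixed dominating function, the second
  -- vanishes in the limit by Cauchy–Schwarz.
  have heq : ∀ n, ((∫ x in Ω, deriv T (φ n x) * η x * ‖G x‖ ^ 2) +
      ∫ x in Ω, deriv T (φ n x) * η x * inner ℝ (G x) (gradient (φ n) x - G x)) +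
      ∫ x in Ω, T (φ n x) * inner ℝ (G x) (gradient η x) =
      ∫ x in Ω, f x * (T (φ n x) * η x) := by
    intro n
    have i12 : IntegrableOn (fun x => deriv T (φ n x) * η x * ‖G x‖ ^ 2 +
        deriv T (φ n x) * η x * inner ℝ (G x) (gradient (φ n) x - G x)) Ω := (i2 n).add (i1 n)
    rw [← hu.weak_eq_comp_mul hη hT hT0 (φ n), ← integral_add (i2 n) (i1 n),
      ← integral_add i12 (i3 n)]
    refine integral_congr_ae (ae_of_all _ fun x => ?_)
    simp only [inner_sub_right, real_inner_self_eq_norm_sq]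
    ring
  have l1 : Tendsto (fun n => ∫ x in Ω, deriv T (φ n x) * η x * ‖G x‖ ^ 2) atTop
      (𝓝 (∫ x in Ω, deriv T (u x) * η x * ‖G x‖ ^ 2)) := by
    refine tendsto_integral_of_dominated_convergence (fun x => C * ‖G x‖ ^ 2)
      (fun n => (i2 n).aestronglyMeasurable) (hG2.const_mul C)
      (fun n => ae_of_all _ fun x => ?_) ?_
    · rw [norm_mul, norm_pow, norm_norm]
      exact mul_le_mul_of_nonneg_right (hbd _ _) (sq_nonneg _)
    · filter_upwards [hae] with x hx
      exact (((hdT.tendsto _).comp hx).mul_const _).mul_const _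
  have l2 : Tendsto (fun n => ∫ x in Ω, deriv T (φ n x) * η x *
      inner ℝ (G x) (gradient (φ n) x - G x)) atTop (𝓝 0) := by
    have hd : ∀ n, MemLp (fun x => gradient (φ n) x - G x) 2 (volume.restrict Ω) := fun n =>
      (memLp_gradient_testFunction (φ n) _).sub hu.memLp_grad
    have h3 := tendsto_integral_inner (μ := volume.restrict (Ω : Set (Euc N)))
      (f := fun _ x => ‖G x‖) (f' := fun x => ‖G x‖)
      (g := fun n x => ‖gradient (φ n) x - G x‖) (g' := fun _ => (0 : ℝ))
      (fun _ => hu.memLp_grad.norm) (fun n => (hd n).norm) hu.memLp_grad.norm MemLp.zero'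
      (by simp) (by simpa only [sub_zero, eLpNorm_norm] using h2)
    simp only [inner_zero_right, integral_zero] at h3
    refine squeeze_zero_norm (fun n => ?_) (by simpa using h3.const_mul C)
    rw [← integral_const_mul]
    refine norm_integral_le_of_norm_le (((hu.memLp_grad.norm.integrable_mul
      (hd n).norm).const_mul C).congr (ae_of_all _ fun x => ?_)) (ae_of_all _ fun x => ?_)
    · simp [mul_comm]
    · rw [norm_mul]
      refine mul_le_mul (hbd _ _) ((norm_inner_le_norm _ _).trans (le_of_eq ?_)) (norm_nonneg _) hC0
      simp [mul_comm]
  have l3 : Tendsto (fun n => ∫ x in Ω, T (φ n x) * inner ℝ (G x) (gradient η x)) atTop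
      (𝓝 (∫ x in Ω, T (u x) * inner ℝ (G x) (gradient η x))) := by
    refine tendsto_integral_of_dominated_convergence (fun x => M * (‖G x‖ * ‖gradient η x‖))
      (fun n => (i3 n).aestronglyMeasurable) (hG1.const_mul M)
      (fun n => ae_of_all _ fun x => ?_) ?_
    · rw [norm_mul]
      exact mul_le_mul (hTM _) (norm_inner_le_norm _ _) (norm_nonneg _) hM0
    · filter_upwards [hae] with x hx
      exact ((hTc.tendsto _).comp hx).mul_const _
  have l4 : Tendsto (fun n => ∫ x in Ω, f x * (T (φ n x) * η x)) atTop
      (𝓝 (∫ x in Ω, f x * (T (u x) * η x))) := by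
    refine tendsto_integral_of_dominated_convergence (fun x => ‖f x‖ * (M * C))
      (fun n => hf.aestronglyMeasurable.mul ((hTc.comp_aestronglyMeasurable (hφm n)).mul
        hηcont.aestronglyMeasurable)) (hf.norm.mul_const _)
      (fun n => ae_of_all _ fun x => ?_) ?_
    · rw [norm_mul, norm_mul]
      exact mul_le_mul_of_nonneg_left (mul_le_mul (hTM _) (hC x) (norm_nonneg _) hM0)
        (norm_nonneg _)
    · filter_upwards [hae] with x hx
      exact (((hTc.tendsto _).comp hx).mul_const _).const_mul _
  have l5 := (l1.add l2).add l3
  rw [add_zero] at l5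
  exact tendsto_nhds_unique (l5.congr heq) l4

/-- The truncations T(s) = arctan(εs)/ε are smooth and bounded, have slope in (0, 1] and tend to the
identity. Since |T(s)| ≤ |s|, the assumed integrability of f u η dominates the source term. -/
theorem IsWeakSolution.energy_identity (hu : IsWeakSolution Ω f u G)
    (hf : IntegrableOn f Ω) (hη : ContDiff ℝ (⊤ : ℕ∞) η) (hηc : HasCompactSupport η)
    (hfu : IntegrableOn (fun x => f x * u x * η x) Ω) :
    (∫ x in Ω, ‖G x‖ ^ 2 * η x) + ∫ x in Ω, u x * inner ℝ (G x) (gradient η x) =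
      ∫ x in Ω, f x * u x * η x := by
  obtain ⟨ε, hε, hε0⟩ : ∃ ε : ℕ → ℝ, (∀ n, 0 < ε n) ∧ Tendsto ε atTop (𝓝 0) :=
    ⟨fun n => 1 / ((n : ℝ) + 1), fun n => by positivity, tendsto_one_div_add_atTop_nhds_zero_nat⟩
  obtain ⟨T, hTdef⟩ : ∃ T : ℕ → ℝ → ℝ, T = fun n s => (ε n)⁻¹ * Real.arctan (ε n * s) := ⟨_, rfl⟩
  have hTs : ∀ n, ContDiff ℝ (⊤ : ℕ∞) (T n) := by
    intro n
    rw [hTdef]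
    exact contDiff_const.mul (Real.contDiff_arctan.comp (contDiff_const.mul contDiff_id))
  have hT0 : ∀ n, T n 0 = 0 := by simp [hTdef]
  have hder : ∀ n s, deriv (T n) s = 1 / (1 + (ε n * s) ^ 2) := by
    intro n s
    rw [hTdef]
    have h1 : HasDerivAt (fun s => ε n * s) (ε n) s := by
      simpa using (hasDerivAt_id s).const_mul (ε n)
    rw [(h1.arctan.const_mul (ε n)⁻¹).deriv]
    field_simp [(hε n).ne']
  have hder1 : ∀ n s, |deriv (T n) s| ≤ 1 := by
    intro n s
    rw [hder, abs_of_nonneg (by positivity), div_le_one (by positivity)]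
    nlinarith [sq_nonneg (ε n * s)]
  have hTle : ∀ n s, |T n s| ≤ |s| := fun n =>
    abs_le_abs_of_abs_deriv_le_one ((hTs n).differentiable (by simp)) (hT0 n) (hder1 n)
  have hTM : ∀ n s, |T n s| ≤ (ε n)⁻¹ * (Real.pi / 2) := by
    intro n s
    rw [hTdef, abs_mul, abs_of_pos (inv_pos.2 (hε n))]
    refine mul_le_mul_of_nonneg_left ?_ (inv_pos.2 (hε n)).le
    exact abs_le.2 ⟨(Real.neg_pi_div_two_lt_arctan _).le, (Real.arctan_lt_pi_div_two _).le⟩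
  have hTlim : ∀ s, Tendsto (fun n => T n s) atTop (𝓝 s) := by
    intro s
    -- The limit of arctan(εs)/ε is the derivative of t ↦ arctan(ts) at 0.
    have h1 : HasDerivAt (fun t => Real.arctan (t * s)) s 0 := by
      have h2 : HasDerivAt (fun t => t * s) s 0 := by simpa using (hasDerivAt_id (0 : ℝ)).mul_const s
      simpa using h2.arctan
    have h3 := h1.tendsto_slope_zero.comp (tendsto_nhdsWithin_iff.2
      ⟨hε0, Eventually.of_forall fun n => (hε n).ne'⟩)
    simpa [hTdef, Function.comp_def] using h3
  have hdlim : ∀ s, Tendsto (fun n => deriv (T n) s) atTop (𝓝 1) := by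
    intro s
    simp only [hder]
    have : Tendsto (fun n => 1 / (1 + (ε n * s) ^ 2)) atTop (𝓝 (1 / (1 + (0 * s) ^ 2))) :=
      tendsto_const_nhds.div (((hε0.mul_const s).pow 2).const_add 1) (by simp)
    simpa using this
  have heq := fun n => hu.truncated_identity hf hη hηc (hTs n) (hT0 n) (hTM n) (hder1 n)
  obtain ⟨C, hC⟩ := hηc.exists_bound_of_continuous hη.continuous
  have hηg := continuous_gradient hη
  have hηgc : HasCompactSupport (gradient η) :=
    (hηc.fderiv ℝ).comp_left (g := (InnerProductSpace.toDual ℝ (Euc N)).symm) (map_zero _)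
  obtain ⟨D, hD⟩ := hηgc.exists_bound_of_continuous hηg
  have hum := hu.memLp.aestronglyMeasurable
  have hGm := hu.memLp_grad.aestronglyMeasurable
  have hdT : ∀ n, Continuous (deriv (T n)) := fun n => (hTs n).continuous_deriv (by simp)
  have hG2 : IntegrableOn (fun x => ‖G x‖ ^ 2) Ω := hu.memLp_grad.norm.integrable_sq
  have l1 : Tendsto (fun n => ∫ x in Ω, deriv (T n) (u x) * η x * ‖G x‖ ^ 2) atTop
      (𝓝 (∫ x in Ω, ‖G x‖ ^ 2 * η x)) := by
    refine tendsto_integral_of_dominated_convergence (fun x => C * ‖G x‖ ^ 2)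
      (fun n => (((hdT n).comp_aestronglyMeasurable hum).mul
        hη.continuous.aestronglyMeasurable).mul (hGm.norm.pow 2)) (hG2.const_mul C)
      (fun n => ae_of_all _ fun x => ?_) (ae_of_all _ fun x => ?_)
    · rw [norm_mul, norm_mul, norm_pow, norm_norm]
      refine mul_le_mul_of_nonneg_right ?_ (sq_nonneg _)
      exact (mul_le_of_le_one_left (norm_nonneg _) (hder1 n _)).trans (hC x)
    · have := ((hdlim (u x)).mul_const (η x)).mul_const (‖G x‖ ^ 2)
      rwa [one_mul, mul_comm (η x)] at this
  have l2 : Tendsto (fun n => ∫ x in Ω, T n (u x) * inner ℝ (G x) (gradient η x)) atTop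
      (𝓝 (∫ x in Ω, u x * inner ℝ (G x) (gradient η x))) := by
    refine tendsto_integral_of_dominated_convergence (fun x => ‖u x‖ * ‖G x‖ * D)
      (fun n => ((hTs n).continuous.comp_aestronglyMeasurable hum).mul
        (hGm.inner hηg.aestronglyMeasurable))
      ((hu.memLp.norm.integrable_mul hu.memLp_grad.norm).mul_const D)
      (fun n => ae_of_all _ fun x => ?_) (ae_of_all _ fun x => ?_)
    · rw [norm_mul, mul_assoc]
      exact mul_le_mul (hTle n _) ((norm_inner_le_norm _ _).trans (by gcongr; exact hD x))
        (norm_nonneg _) (norm_nonneg _)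
    · exact (hTlim _).mul_const _
  have l3 : Tendsto (fun n => ∫ x in Ω, f x * (T n (u x) * η x)) atTop
      (𝓝 (∫ x in Ω, f x * u x * η x)) := by
    refine tendsto_integral_of_dominated_convergence (fun x => ‖f x * u x * η x‖)
      (fun n => hf.aestronglyMeasurable.mul (((hTs n).continuous.comp_aestronglyMeasurable hum).mul
        hη.continuous.aestronglyMeasurable)) hfu.norm
      (fun n => ae_of_all _ fun x => ?_) (ae_of_all _ fun x => ?_)
    · rw [norm_mul, norm_mul, norm_mul, norm_mul, mul_assoc]
      gcongr
      exact hTle n _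
    · simpa only [mul_assoc] using ((hTlim (u x)).mul_const (η x)).const_mul (f x)
  exact tendsto_nhds_unique ((l1.add l2).congr heq) l3

end EnergyIdentity

/-! ### Fatou's lemma, cutoffs, regularized weights and integrability. -/

theorem lintegral_le_of_ae_tendsto {α : Type*} [MeasurableSpace α] {μ : Measure α}
    {F : ℕ → α → ℝ≥0∞} {F' : α → ℝ≥0∞} {C : ℝ≥0∞} (hF : ∀ n, AEMeasurable (F n) μ)
    (hlim : ∀ᵐ x ∂μ, Tendsto (fun n => F n x) atTop (𝓝 (F' x))) (hC : ∀ n, ∫⁻ x, F n x ∂μ ≤ C) :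
    ∫⁻ x, F' x ∂μ ≤ C := by
  have h1 : ∫⁻ x, F' x ∂μ = ∫⁻ x, liminf (fun n => F n x) atTop ∂μ := by
    refine lintegral_congr_ae ?_
    filter_upwards [hlim] with x hx using hx.liminf_eq.symm
  rw [h1]
  refine (lintegral_liminf_le' hF).trans ?_
  refine (liminf_le_liminf (v := fun _ => C) (Eventually.of_forall hC)).trans ?_
  rw [liminf_const]

theorem ae_ne_point (hN : 1 ≤ N) (x₀ : Euc N) (s : Set (Euc N)) :
    ∀ᵐ x ∂(volume.restrict s), x ≠ x₀ := by
  have : Nonempty (Fin N) := ⟨⟨0, hN⟩⟩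
  have : Nontrivial (Euc N) := inferInstance
  exact ae_restrict_of_ae (compl_mem_ae_iff.2 (measure_singleton x₀))

/-- A smooth nonincreasing nonnegative cutoff on the line, constant to the left of `ρ₁ > 0` and zero
to the right of `ρ₂`. -/
structure IsCutoff (H : ℝ → ℝ) (ρ₁ ρ₂ : ℝ) : Prop where
  pos : 0 < ρ₁
  contDiff : ContDiff ℝ (⊤ : ℕ∞) H
  nonneg : ∀ t, 0 ≤ H t
  eq_zero : ∀ t, ρ₂ ≤ t → H t = 0
  deriv_nonpos : ∀ t, deriv H t ≤ 0
  deriv_eq_zero : ∀ t, t ∉ Ioo ρ₁ ρ₂ → deriv H t = 0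

/-- The singularity of the power at 0 is harmless because `deriv H` vanishes up to `ρ₁ > 0`. -/
theorem IsCutoff.continuous_rpow_mul_deriv {H : ℝ → ℝ} {ρ₁ ρ₂ : ℝ} (hH : IsCutoff H ρ₁ ρ₂) (p : ℝ) :
    Continuous fun t => t ^ (-p) * (- deriv H t) := by
  have h1 : (fun t => t ^ (-p) * (- deriv H t)) = fun t => (max t ρ₁) ^ (-p) * (- deriv H t) := by
    ext t
    by_cases ht : ρ₁ < t
    · rw [max_eq_left ht.le]
    · rw [hH.deriv_eq_zero t fun h => ht h.1]
      simp
  rw [h1]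
  have hd : Continuous (deriv H) := hH.contDiff.continuous_deriv (by simp)
  exact ((continuous_id.max continuous_const).rpow_const fun t =>
    Or.inl (hH.pos.trans_le (le_max_right _ _)).ne').mul hd.neg

theorem hasDerivAt_add_rpow_mul {H : ℝ → ℝ} (hH : Differentiable ℝ H) {ε t : ℝ} (hε : 0 < t + ε)
    (q : ℝ) :
    HasDerivAt (fun t => (t + ε) ^ q * H t)
      (q * (t + ε) ^ (q - 1) * H t + (t + ε) ^ q * deriv H t) t := by
  have h1 : HasDerivAt (fun t => (t + ε) ^ q) (q * (t + ε) ^ (q - 1)) t := by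
    simpa using ((hasDerivAt_id t).add_const ε).rpow_const (p := q) (Or.inl hε.ne')
  exact h1.mul (hH t).hasDerivAt

theorem contDiff_add_rpow_mul {H : ℝ → ℝ} {n : WithTop ℕ∞} (hH : ContDiff ℝ n H) {ε : ℝ}
    (hε : 0 < ε) (q : ℝ) (x₀ : Euc N) :
    ContDiff ℝ n fun x : Euc N => (‖x - x₀‖ ^ 2 + ε) ^ q * H (‖x - x₀‖ ^ 2) := by
  have h1 : ContDiff ℝ n fun x : Euc N => ‖x - x₀‖ ^ 2 := (contDiff_id.sub contDiff_const).norm_sq ℝ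
  exact ((h1.add contDiff_const).rpow_const_of_ne fun x => by positivity).mul (hH.comp h1)

section Integrability

variable {Ω : Opens (Euc N)} {u : Euc N → ℝ} {G : Euc N → Euc N} {b : Euc N → ℝ}

theorem MemW12.integrableOn_mul_sq (hu : MemW12 Ω u G) (hb : Continuous b)
    (hbc : HasCompactSupport b) : IntegrableOn (fun x => b x * u x ^ 2) Ω := by
  obtain ⟨C, hC⟩ := hbc.exists_bound_of_continuous hb
  exact hu.memLp.integrable_sq.bdd_mul hb.aestronglyMeasurable (ae_of_all _ hC)

theorem MemW12.integrableOn_mul_norm_sq (hu : MemW12 Ω u G) (hb : Continuous b)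
    (hbc : HasCompactSupport b) : IntegrableOn (fun x => b x * ‖G x‖ ^ 2) Ω := by
  obtain ⟨C, hC⟩ := hbc.exists_bound_of_continuous hb
  exact hu.memLp_grad.norm.integrable_sq.bdd_mul hb.aestronglyMeasurable (ae_of_all _ hC)

theorem MemW12.integrableOn_mul_inner (hu : MemW12 Ω u G) (x₀ : Euc N) (hb : Continuous b)
    (hbc : HasCompactSupport b) :
    IntegrableOn (fun x => b x * (u x * inner ℝ (G x) (x - x₀))) Ω := by
  have hc : HasCompactSupport fun x => b x • (x - x₀) := hbc.smul_right
  have hbx : Continuous fun x => b x • (x - x₀) := by fun_prop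
  obtain ⟨C, hC⟩ := hc.exists_bound_of_continuous hbx
  refine ((hu.memLp.norm.integrable_mul hu.memLp_grad.norm).mul_const C).mono'
    (hb.aestronglyMeasurable.mul (hu.memLp.aestronglyMeasurable.mul
      (hu.memLp_grad.aestronglyMeasurable.inner (by fun_prop)))) (ae_of_all _ fun x => ?_)
  rw [mul_left_comm, ← inner_smul_right, norm_mul]
  change _ ≤ ‖u x‖ * ‖G x‖ * C
  rw [mul_assoc]
  exact mul_le_mul_of_nonneg_left ((norm_inner_le_norm _ _).trans
    (mul_le_mul_of_nonneg_left (hC x) (norm_nonneg _))) (norm_nonneg _)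

theorem MemW12.integrableOn_mul_inner_sq (hu : MemW12 Ω u G) (x₀ : Euc N) (hb : Continuous b)
    (hbc : HasCompactSupport b) :
    IntegrableOn (fun x => b x * inner ℝ (G x) (x - x₀) ^ 2) Ω := by
  have hc : HasCompactSupport fun x => b x * ‖x - x₀‖ ^ 2 := hbc.mul_right
  have hbx : Continuous fun x => b x * ‖x - x₀‖ ^ 2 := by fun_prop
  obtain ⟨C, hC⟩ := hc.exists_bound_of_continuous hbx
  refine (hu.memLp_grad.norm.integrable_sq.const_mul C).mono'
    (hb.aestronglyMeasurable.mul
      ((hu.memLp_grad.aestronglyMeasurable.inner (by fun_prop)).pow 2)) (ae_of_all _ fun x => ?_)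
  rw [norm_mul, norm_pow]
  calc ‖b x‖ * ‖inner ℝ (G x) (x - x₀)‖ ^ 2 ≤ ‖b x‖ * (‖G x‖ * ‖x - x₀‖) ^ 2 := by
        gcongr
        exact norm_inner_le_norm _ _
    _ = ‖b x * ‖x - x₀‖ ^ 2‖ * ‖G x‖ ^ 2 := by
        rw [norm_mul, norm_pow, norm_norm]
        ring
    _ ≤ C * ‖G x‖ ^ 2 := by
        gcongr
        exact hC x

end Integrability

/-! ### The weighted energy inequality for a smooth cutoff. -/

section Cutoff

variable {Ω : Opens (Euc N)} {f u : Euc N → ℝ} {G : Euc N → Euc N} {x₀ : Euc N}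
  {r₀ σ a p ρ₁ ρ₂ : ℝ} {H : ℝ → ℝ}

/-- The relation `hap` says a + 2p = a⁻¹σ; hence the Poincaré inequality trades the u² term for a⁻¹
times the tangential energy, and the radial term completes it to the full gradient. -/
theorem MemW012.boundary_term_le (hu : MemW012 Ω u G) (hN : 1 ≤ N) (hr₀ : 0 < r₀) (hσ0 : 0 < σ)
    (hσ : ENNReal.ofReal σ ≤
      (⨅ r ∈ Ioo (0 : ℝ) r₀, ENNReal.ofReal (r ^ 2) * sphericalEigenvalue Ω x₀ r))
    (ha : 0 < a) (hap : a * (a + 2 * p) = σ) {κ : ℝ → ℝ} (hκ : Continuous κ) (hκ0 : ∀ t, 0 ≤ κ t)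
    (hκs : ∀ t, t ∉ Ioo 0 (r₀ ^ 2) → κ t = 0) :
    ∫ x in Ω, κ (‖x - x₀‖ ^ 2) *
        ((a + 2 * p) * u x ^ 2 + a⁻¹ * inner ℝ (G x) (x - x₀) ^ 2) ≤
      a⁻¹ * ∫ x in Ω, κ (‖x - x₀‖ ^ 2) * (‖x - x₀‖ ^ 2 * ‖G x‖ ^ 2) := by
  have h := hu.poincare hN hσ0.le hr₀ hσ hκ hκ0 hκs
  have hκc : Continuous fun x : Euc N => κ (‖x - x₀‖ ^ 2) := by fun_prop
  have hκS : HasCompactSupport fun x : Euc N => κ (‖x - x₀‖ ^ 2) :=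
    hasCompactSupport_comp_normSq x₀ (R := r₀ ^ 2) fun x hx =>
      hκs _ fun h => absurd h.2 (not_lt.2 hx)
  have i1 := hu.integrableOn_mul_sq hκc hκS
  have i2 := hu.integrableOn_mul_inner_sq x₀ hκc hκS
  have i3 : IntegrableOn (fun x => κ (‖x - x₀‖ ^ 2) * (‖x - x₀‖ ^ 2 * ‖G x‖ ^ 2)) Ω := by
    simp only [← mul_assoc]
    exact hu.integrableOn_mul_norm_sq (b := fun x => κ (‖x - x₀‖ ^ 2) * ‖x - x₀‖ ^ 2) (by fun_prop)
      hκS.mul_right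
  simp only [mul_sub] at h
  rw [integral_sub i3 i2] at h
  have e : ∀ x, κ (‖x - x₀‖ ^ 2) * ((a + 2 * p) * u x ^ 2 + a⁻¹ * inner ℝ (G x) (x - x₀) ^ 2) =
      (a + 2 * p) * (κ (‖x - x₀‖ ^ 2) * u x ^ 2) +
        a⁻¹ * (κ (‖x - x₀‖ ^ 2) * inner ℝ (G x) (x - x₀) ^ 2) := fun x => by ring
  simp only [e]
  rw [integral_add (i1.const_mul _) (i2.const_mul _), integral_const_mul, integral_const_mul]
  have h2 : a + 2 * p = a⁻¹ * σ := by
    rw [← hap]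
    field_simp
  rw [h2, mul_assoc, ← mul_add]
  refine mul_le_mul_of_nonneg_left ?_ (inv_pos.2 ha).le
  linarith

/-- Integrand of the cross term after integration by parts, with t = |x - x₀|², m = -H'(t), h =
H(t), s = ∇u·(x - x₀) and N = 2p + 2. Young's inequality with parameter `a` handles the product u s.
-/
theorem cutoff_pointwise (hp : 0 ≤ p) (ha : 0 < a) {t ε m h u s B D : ℝ} (hε : 0 < ε) (ht : 0 ≤ t)
    (hm : 0 ≤ m) (hmt : m ≠ 0 → 0 < t) (hh : 0 ≤ h) (hB : B = (t + ε) ^ (-p - 1))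
    (hD : D = (t + ε) ^ (-p - 2)) :
    2 * ((t + ε) ^ (-p) * m) * (u * s) -
      2⁻¹ * (2 * p * (((2 * p + 2) * B - 2 * (p + 1) * t * D) * h - 2 * t * B * m) * u ^ 2) ≤
      t ^ (-p) * m * ((a + 2 * p) * u ^ 2 + a⁻¹ * s ^ 2) := by
  have hte : 0 < t + ε := by linarith
  have hBA : (t + ε) ^ (-p) = (t + ε) * B := by
    rw [hB, Real.rpow_sub_one hte.ne']
    field_simp
  have hDB : B = (t + ε) * D := by
    rw [hB, hD, show -p - 2 = -p - 1 - 1 by ring, Real.rpow_sub_one hte.ne' (-p - 1)]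
    field_simp
  have hD0 : 0 ≤ D := hD ▸ Real.rpow_nonneg hte.le _
  have hB0 : 0 ≤ B := hB ▸ Real.rpow_nonneg hte.le _
  have h1 : (2 * p + 2) * B - 2 * (p + 1) * t * D = 2 * (p + 1) * ε * D := by
    rw [hDB]
    ring
  rw [h1]
  -- This term has a sign because (|x|² + ε)^(-p) is superharmonic when 2p = N - 2; it is discarded.
  have h2 : 0 ≤ p * (2 * (p + 1) * ε * D * h) * u ^ 2 := by positivity
  -- Comparison of (t + ε)^(-p) with t^(-p) needs t > 0, which is known only where `m ≠ 0`.
  by_cases hm0 : m = 0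
  · rw [hm0]
    nlinarith
  have htp := hmt hm0
  have hAt : (t + ε) ^ (-p) ≤ t ^ (-p) :=
    Real.rpow_le_rpow_of_nonpos htp (by linarith) (by linarith)
  have htB : t * B ≤ t ^ (-p) := by
    refine le_trans ?_ hAt
    rw [hBA]
    nlinarith
  have hA0 : 0 ≤ (t + ε) ^ (-p) := Real.rpow_nonneg hte.le _
  have hy : 2 * (u * s) ≤ a * u ^ 2 + a⁻¹ * s ^ 2 := by
    have : 0 ≤ a⁻¹ * (a * u - s) ^ 2 := by positivity
    have e : a⁻¹ * (a * u - s) ^ 2 = a * u ^ 2 + a⁻¹ * s ^ 2 - 2 * (u * s) := by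
      field_simp
      ring
    linarith
  have hq : 0 ≤ a * u ^ 2 + a⁻¹ * s ^ 2 := by positivity
  have h3 : (t + ε) ^ (-p) * m * (2 * (u * s)) ≤ t ^ (-p) * m * (a * u ^ 2 + a⁻¹ * s ^ 2) :=
    (mul_le_mul_of_nonneg_left hy (mul_nonneg hA0 hm)).trans
      (mul_le_mul_of_nonneg_right (mul_le_mul_of_nonneg_right hAt hm) hq)
  have h4 : t * B * (2 * p * m * u ^ 2) ≤ t ^ (-p) * (2 * p * m * u ^ 2) :=
    mul_le_mul_of_nonneg_right htB (by positivity)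
  nlinarith

/-- Only the part of the gradient falling on the power is integrated by parts; the part with `deriv
H` is kept and estimated pointwise. -/
theorem MemW012.cross_term_le (hu : MemW012 Ω u G) (hN : 2 ≤ N)
    (hp : 2 * p = (N : ℝ) - 2) (hr₀ : 0 < r₀) (hσ0 : 0 < σ)
    (hσ : ENNReal.ofReal σ ≤
      (⨅ r ∈ Ioo (0 : ℝ) r₀, ENNReal.ofReal (r ^ 2) * sphericalEigenvalue Ω x₀ r))
    (ha : 0 < a) (hap : a * (a + 2 * p) = σ) (hH : IsCutoff H ρ₁ ρ₂) (hρ : ρ₂ ≤ r₀ ^ 2)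
    {ε : ℝ} (hε : 0 < ε) :
    -∫ x in Ω, u x * (2 * (-p * (‖x - x₀‖ ^ 2 + ε) ^ (-p - 1) * H (‖x - x₀‖ ^ 2) +
        (‖x - x₀‖ ^ 2 + ε) ^ (-p) * deriv H (‖x - x₀‖ ^ 2)) * inner ℝ (G x) (x - x₀)) ≤
      a⁻¹ * ∫ x in Ω, (‖x - x₀‖ ^ 2) ^ (-p) * (- deriv H (‖x - x₀‖ ^ 2)) *
        (‖x - x₀‖ ^ 2 * ‖G x‖ ^ 2) := by
  have hN2 : (2 : ℝ) ≤ N := by exact_mod_cast hN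
  have hp0 : 0 ≤ p := by linarith
  have hHd : Differentiable ℝ H := hH.contDiff.differentiable (by simp)
  have hHc := hH.contDiff.continuous
  have hdH : Continuous (deriv H) := hH.contDiff.continuous_deriv (by simp)
  have hte : ∀ x : Euc N, 0 < ‖x - x₀‖ ^ 2 + ε := fun x => by positivity
  have hrp : ∀ q : ℝ, Continuous fun x : Euc N => (‖x - x₀‖ ^ 2 + ε) ^ q := fun q =>
    Continuous.rpow_const (by fun_prop) fun x => Or.inl (hte x).ne'
  have hHS : HasCompactSupport fun x : Euc N => H (‖x - x₀‖ ^ 2) :=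
    hasCompactSupport_comp_normSq x₀ (R := ρ₂) fun x hx => hH.eq_zero _ hx
  have hdHS : HasCompactSupport fun x : Euc N => deriv H (‖x - x₀‖ ^ 2) :=
    hasCompactSupport_comp_normSq x₀ (R := ρ₂) fun x hx =>
      hH.deriv_eq_zero _ fun h => absurd h.2 (not_lt.2 hx)
  have hηS : ∀ q : ℝ, HasCompactSupport fun x : Euc N =>
      (‖x - x₀‖ ^ 2 + ε) ^ q * H (‖x - x₀‖ ^ 2) := fun q => hHS.mul_left
  have hI := hu.integral_sq_mul_add_fderiv (x₀ := x₀)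
    ((contDiff_add_rpow_mul hH.contDiff hε (-p - 1) x₀).of_le (by simp)) (hηS (-p - 1))
  have hfd : ∀ x : Euc N,
      fderiv ℝ (fun x => (‖x - x₀‖ ^ 2 + ε) ^ (-p - 1) * H (‖x - x₀‖ ^ 2)) x (x - x₀) =
      2 * ‖x - x₀‖ ^ 2 * ((-p - 1) * (‖x - x₀‖ ^ 2 + ε) ^ (-p - 2) * H (‖x - x₀‖ ^ 2) +
        (‖x - x₀‖ ^ 2 + ε) ^ (-p - 1) * deriv H (‖x - x₀‖ ^ 2)) := by
    intro x
    have h1 := hasGradientAt_comp_normSq (g := fun t => (t + ε) ^ (-p - 1) * H t)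
      (hasDerivAt_add_rpow_mul hHd (hte x) (-p - 1))
    rw [h1.hasFDerivAt.fderiv, InnerProductSpace.toDual_apply_apply, real_inner_smul_left,
      real_inner_self_eq_norm_sq, show -p - 1 - 1 = -p - 2 by ring]
    ring
  simp only [hfd] at hI
  have j1 : IntegrableOn (fun x => (‖x - x₀‖ ^ 2 + ε) ^ (-p - 1) * H (‖x - x₀‖ ^ 2) *
      (u x * inner ℝ (G x) (x - x₀))) Ω :=
    hu.integrableOn_mul_inner x₀ ((hrp _).mul (by fun_prop)) (hηS _)
  have j2 : IntegrableOn (fun x => (‖x - x₀‖ ^ 2 + ε) ^ (-p) * - deriv H (‖x - x₀‖ ^ 2) *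
      (u x * inner ℝ (G x) (x - x₀))) Ω :=
    hu.integrableOn_mul_inner x₀ ((hrp _).mul (by fun_prop)) hdHS.neg.mul_left
  have j3 : IntegrableOn (fun x => ((N : ℝ) * ((‖x - x₀‖ ^ 2 + ε) ^ (-p - 1) * H (‖x - x₀‖ ^ 2)) +
      2 * ‖x - x₀‖ ^ 2 * ((-p - 1) * (‖x - x₀‖ ^ 2 + ε) ^ (-p - 2) * H (‖x - x₀‖ ^ 2) +
        (‖x - x₀‖ ^ 2 + ε) ^ (-p - 1) * deriv H (‖x - x₀‖ ^ 2))) * u x ^ 2) Ω := by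
    refine hu.integrableOn_mul_sq ?_ ?_
    · have h1 := hrp (-p - 1)
      have h2 := hrp (-p - 2)
      fun_prop
    · exact (hηS _).mul_left.add ((hHS.mul_left.add hdHS.mul_left).mul_left)
  have hκ := hH.continuous_rpow_mul_deriv p
  have hκ0 : ∀ t, 0 ≤ t ^ (-p) * (- deriv H t) := by
    intro t
    by_cases ht : t ∈ Ioo ρ₁ ρ₂
    · exact mul_nonneg (Real.rpow_nonneg (hH.pos.trans ht.1).le _)
        (neg_nonneg.2 (hH.deriv_nonpos t))
    · simp [hH.deriv_eq_zero t ht]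
  have hκs : ∀ t, t ∉ Ioo 0 (r₀ ^ 2) → t ^ (-p) * (- deriv H t) = 0 := fun t ht => by
    rw [hH.deriv_eq_zero t fun h => ht ⟨hH.pos.trans h.1, h.2.trans_le hρ⟩]
    simp
  have hB := hu.boundary_term_le (x₀ := x₀) (by omega) hr₀ hσ0 hσ ha hap hκ hκ0 hκs
  have hκc : Continuous fun x : Euc N =>
      (‖x - x₀‖ ^ 2) ^ (-p) * (- deriv H (‖x - x₀‖ ^ 2)) := hκ.comp (by fun_prop)
  have hκS : HasCompactSupport fun x : Euc N =>
      (‖x - x₀‖ ^ 2) ^ (-p) * (- deriv H (‖x - x₀‖ ^ 2)) := hdHS.neg.mul_left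
  have j4 : IntegrableOn (fun x => (‖x - x₀‖ ^ 2) ^ (-p) * (- deriv H (‖x - x₀‖ ^ 2)) *
        ((a + 2 * p) * u x ^ 2 + a⁻¹ * inner ℝ (G x) (x - x₀) ^ 2)) Ω := by
    have h1 := ((hu.integrableOn_mul_sq hκc hκS).const_mul (a + 2 * p)).add
      ((hu.integrableOn_mul_inner_sq x₀ hκc hκS).const_mul a⁻¹)
    refine h1.congr (ae_of_all _ fun x => ?_)
    simp only [Pi.add_apply]
    ring
  refine le_trans ?_ hB
  have e1 : ∀ x, u x * (2 * (-p * (‖x - x₀‖ ^ 2 + ε) ^ (-p - 1) * H (‖x - x₀‖ ^ 2) +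
      (‖x - x₀‖ ^ 2 + ε) ^ (-p) * deriv H (‖x - x₀‖ ^ 2)) * inner ℝ (G x) (x - x₀)) =
      (-2 * p) * ((‖x - x₀‖ ^ 2 + ε) ^ (-p - 1) * H (‖x - x₀‖ ^ 2) *
        (u x * inner ℝ (G x) (x - x₀))) - 2 * ((‖x - x₀‖ ^ 2 + ε) ^ (-p) *
        - deriv H (‖x - x₀‖ ^ 2) * (u x * inner ℝ (G x) (x - x₀))) := fun x => by ring
  have e2 : ∀ x, 2 * ((‖x - x₀‖ ^ 2 + ε) ^ (-p - 1) * H (‖x - x₀‖ ^ 2)) * u x *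
      inner ℝ (G x) (x - x₀) = 2 * ((‖x - x₀‖ ^ 2 + ε) ^ (-p - 1) * H (‖x - x₀‖ ^ 2) *
        (u x * inner ℝ (G x) (x - x₀))) := fun x => by ring
  simp only [e1]
  simp only [e2] at hI
  rw [integral_const_mul] at hI
  rw [integral_sub (j1.const_mul _) (j2.const_mul _), integral_const_mul]
  have h1 : ∫ x in Ω, (2 * ((‖x - x₀‖ ^ 2 + ε) ^ (-p) * - deriv H (‖x - x₀‖ ^ 2) *
        (u x * inner ℝ (G x) (x - x₀))) -
      p * (((N : ℝ) * ((‖x - x₀‖ ^ 2 + ε) ^ (-p - 1) * H (‖x - x₀‖ ^ 2)) +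
    2 * ‖x - x₀‖ ^ 2 * ((-p - 1) * (‖x - x₀‖ ^ 2 + ε) ^ (-p - 2) * H (‖x - x₀‖ ^ 2) +
      (‖x - x₀‖ ^ 2 + ε) ^ (-p - 1) * deriv H (‖x - x₀‖ ^ 2))) * u x ^ 2)) ≤
    ∫ x in Ω, (‖x - x₀‖ ^ 2) ^ (-p) * (- deriv H (‖x - x₀‖ ^ 2)) *
      ((a + 2 * p) * u x ^ 2 + a⁻¹ * inner ℝ (G x) (x - x₀) ^ 2) := by
    refine integral_mono ((j2.const_mul 2).sub (j3.const_mul p)) j4 fun x => ?_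
    have h2 := cutoff_pointwise (p := p) (a := a) hp0 ha (t := ‖x - x₀‖ ^ 2) (ε := ε)
      (m := - deriv H (‖x - x₀‖ ^ 2)) (h := H (‖x - x₀‖ ^ 2)) (u := u x)
      (s := inner ℝ (G x) (x - x₀)) hε (sq_nonneg _) (neg_nonneg.2 (hH.deriv_nonpos _))
      (fun h => by
        by_contra h0
        exact h (by rw [hH.deriv_eq_zero _ fun h3 => h0 (hH.pos.trans h3.1), neg_zero]))
      (hH.nonneg _) rfl rfl
    refine le_trans (le_of_eq ?_) h2
    rw [show (N : ℝ) = 2 * p + 2 by linarith]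
    ring
  rw [integral_sub (j2.const_mul 2) (j3.const_mul p), integral_const_mul p, hI] at h1
  linarith

theorem IsWeakSolution.regularized_energy_le (hu : IsWeakSolution Ω f u G) (hN : 2 ≤ N)
    (hf : IntegrableOn f Ω) (hp : 2 * p = (N : ℝ) - 2) (hr₀ : 0 < r₀) (hσ0 : 0 < σ)
    (hσ : ENNReal.ofReal σ ≤
      (⨅ r ∈ Ioo (0 : ℝ) r₀, ENNReal.ofReal (r ^ 2) * sphericalEigenvalue Ω x₀ r))
    (ha : 0 < a) (hap : a * (a + 2 * p) = σ) (hH : IsCutoff H ρ₁ ρ₂) (hρ : ρ₂ ≤ r₀ ^ 2)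
    (hfu : IntegrableOn (fun x => |u x * f x| * ((‖x - x₀‖ ^ 2) ^ (-p) * H (‖x - x₀‖ ^ 2))) Ω)
    {ε : ℝ} (hε : 0 < ε) :
    ∫ x in Ω, ‖G x‖ ^ 2 * ((‖x - x₀‖ ^ 2 + ε) ^ (-p) * H (‖x - x₀‖ ^ 2)) ≤
      (∫ x in Ω, |u x * f x| * ((‖x - x₀‖ ^ 2) ^ (-p) * H (‖x - x₀‖ ^ 2))) +
      a⁻¹ * ∫ x in Ω, (‖x - x₀‖ ^ 2) ^ (-p) * (- deriv H (‖x - x₀‖ ^ 2)) *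
        (‖x - x₀‖ ^ 2 * ‖G x‖ ^ 2) := by
  have hN2 : (2 : ℝ) ≤ N := by exact_mod_cast hN
  have hp0 : 0 ≤ p := by linarith
  have hHd : Differentiable ℝ H := hH.contDiff.differentiable (by simp)
  have hHc := hH.contDiff.continuous
  have hdH : Continuous (deriv H) := hH.contDiff.continuous_deriv (by simp)
  have hte : ∀ x : Euc N, 0 < ‖x - x₀‖ ^ 2 + ε := fun x => by positivity
  have hrp : ∀ q : ℝ, Continuous fun x : Euc N => (‖x - x₀‖ ^ 2 + ε) ^ q := fun q =>
    Continuous.rpow_const (by fun_prop) fun x => Or.inl (hte x).ne'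
  have hHS : HasCompactSupport fun x : Euc N => H (‖x - x₀‖ ^ 2) :=
    hasCompactSupport_comp_normSq x₀ (R := ρ₂) fun x hx => hH.eq_zero _ hx
  have hdHS : HasCompactSupport fun x : Euc N => deriv H (‖x - x₀‖ ^ 2) :=
    hasCompactSupport_comp_normSq x₀ (R := ρ₂) fun x hx =>
      hH.deriv_eq_zero _ fun h => absurd h.2 (not_lt.2 hx)
  have hηS : ∀ q : ℝ, HasCompactSupport fun x : Euc N =>
      (‖x - x₀‖ ^ 2 + ε) ^ q * H (‖x - x₀‖ ^ 2) := fun q => hHS.mul_left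
  have hle : ∀ᵐ x ∂(volume.restrict (Ω : Set (Euc N))),
      ‖f x * u x * ((‖x - x₀‖ ^ 2 + ε) ^ (-p) * H (‖x - x₀‖ ^ 2))‖ ≤
        |u x * f x| * ((‖x - x₀‖ ^ 2) ^ (-p) * H (‖x - x₀‖ ^ 2)) := by
    filter_upwards [ae_ne_point (by omega) x₀ Ω] with x hx
    have ht : 0 < ‖x - x₀‖ ^ 2 := pow_pos (norm_pos_iff.2 (sub_ne_zero.2 hx)) 2
    rw [norm_mul, Real.norm_eq_abs, mul_comm (f x), Real.norm_eq_abs,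
      abs_of_nonneg (mul_nonneg (Real.rpow_nonneg (hte x).le _) (hH.nonneg _))]
    refine mul_le_mul_of_nonneg_left (mul_le_mul_of_nonneg_right ?_ (hH.nonneg _)) (abs_nonneg _)
    exact Real.rpow_le_rpow_of_nonpos ht (by linarith) (by linarith)
  have hfu' : IntegrableOn (fun x => f x * u x *
      ((‖x - x₀‖ ^ 2 + ε) ^ (-p) * H (‖x - x₀‖ ^ 2))) Ω := by
    refine hfu.mono' ((hf.aestronglyMeasurable.mul hu.memLp.aestronglyMeasurable).mul ?_) hle
    exact ((hrp (-p)).mul (by fun_prop)).aestronglyMeasurable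
  have hE := hu.energy_identity hf (contDiff_add_rpow_mul hH.contDiff hε (-p) x₀) (hηS (-p)) hfu'
  have hgrad : ∀ x : Euc N, gradient (fun x => (‖x - x₀‖ ^ 2 + ε) ^ (-p) * H (‖x - x₀‖ ^ 2)) x =
      (2 * (-p * (‖x - x₀‖ ^ 2 + ε) ^ (-p - 1) * H (‖x - x₀‖ ^ 2) +
        (‖x - x₀‖ ^ 2 + ε) ^ (-p) * deriv H (‖x - x₀‖ ^ 2))) • (x - x₀) := fun x =>
    (hasGradientAt_comp_normSq (g := fun t => (t + ε) ^ (-p) * H t)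
      (hasDerivAt_add_rpow_mul hHd (hte x) (-p))).gradient
  simp only [hgrad, inner_smul_right] at hE
  have hcomb := hu.cross_term_le (x₀ := x₀) hN hp hr₀ hσ0 hσ ha hap hH hρ hε
  have hfle : ∫ x in Ω, f x * u x * ((‖x - x₀‖ ^ 2 + ε) ^ (-p) * H (‖x - x₀‖ ^ 2)) ≤
      ∫ x in Ω, |u x * f x| * ((‖x - x₀‖ ^ 2) ^ (-p) * H (‖x - x₀‖ ^ 2)) :=
    integral_mono_ae hfu' hfu (hle.mono fun x hx => (le_abs_self _).trans hx)
  linarith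

/-- The bound for the regularized weights is uniform in ε, so Fatou's lemma removes ε without prior
knowledge that the left side is finite. -/
theorem IsWeakSolution.lintegral_energy_le (hu : IsWeakSolution Ω f u G) (hN : 2 ≤ N)
    (hf : IntegrableOn f Ω) (hp : 2 * p = (N : ℝ) - 2) (hr₀ : 0 < r₀) (hσ0 : 0 < σ)
    (hσ : ENNReal.ofReal σ ≤
      (⨅ r ∈ Ioo (0 : ℝ) r₀, ENNReal.ofReal (r ^ 2) * sphericalEigenvalue Ω x₀ r))
    (ha : 0 < a) (hap : a * (a + 2 * p) = σ) (hH : IsCutoff H ρ₁ ρ₂) (hρ : ρ₂ ≤ r₀ ^ 2) :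
    ∫⁻ x in Ω, ENNReal.ofReal (‖G x‖ ^ 2 * ((‖x - x₀‖ ^ 2) ^ (-p) * H (‖x - x₀‖ ^ 2))) ≤
      (∫⁻ x in Ω, ENNReal.ofReal (|u x * f x| * ((‖x - x₀‖ ^ 2) ^ (-p) * H (‖x - x₀‖ ^ 2)))) +
      ∫⁻ x in Ω, ENNReal.ofReal (a⁻¹ * ((‖x - x₀‖ ^ 2) ^ (-p) * (- deriv H (‖x - x₀‖ ^ 2)) *
        (‖x - x₀‖ ^ 2 * ‖G x‖ ^ 2))) := by
  have hHc := hH.contDiff.continuous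
  have hGm := hu.memLp_grad.aestronglyMeasurable
  have hm : AEStronglyMeasurable
      (fun x => |u x * f x| * ((‖x - x₀‖ ^ 2) ^ (-p) * H (‖x - x₀‖ ^ 2)))
      (volume.restrict (Ω : Set (Euc N))) := by
    refine (hu.memLp.aestronglyMeasurable.mul hf.aestronglyMeasurable).norm.mul ?_
    have : Measurable fun x : Euc N => (‖x - x₀‖ ^ 2) ^ (-p) * H (‖x - x₀‖ ^ 2) := by
      have := hHc.measurable
      fun_prop
    exact this.aestronglyMeasurable
  have hnn : ∀ x, 0 ≤ |u x * f x| * ((‖x - x₀‖ ^ 2) ^ (-p) * H (‖x - x₀‖ ^ 2)) := fun x =>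
    mul_nonneg (abs_nonneg _) (mul_nonneg (Real.rpow_nonneg (sq_nonneg _) _) (hH.nonneg _))
  -- An infinite source term makes the claim trivial; a finite one supplies the integrability needed
  -- for the energy identity.
  by_cases htop : ∫⁻ x in Ω, ENNReal.ofReal
      (|u x * f x| * ((‖x - x₀‖ ^ 2) ^ (-p) * H (‖x - x₀‖ ^ 2))) = ⊤
  · rw [htop, top_add]
    exact le_top
  have hfu : IntegrableOn
      (fun x => |u x * f x| * ((‖x - x₀‖ ^ 2) ^ (-p) * H (‖x - x₀‖ ^ 2))) Ω :=
    (lintegral_ofReal_ne_top_iff_integrable hm (ae_of_all _ hnn)).1 htop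
  have hdHS : HasCompactSupport fun x : Euc N => deriv H (‖x - x₀‖ ^ 2) :=
    hasCompactSupport_comp_normSq x₀ (R := ρ₂) fun x hx =>
      hH.deriv_eq_zero _ fun h => absurd h.2 (not_lt.2 hx)
  have hκ := hH.continuous_rpow_mul_deriv p
  have hκc : Continuous fun x : Euc N =>
      (‖x - x₀‖ ^ 2) ^ (-p) * (- deriv H (‖x - x₀‖ ^ 2)) := hκ.comp (by fun_prop)
  have hκS : HasCompactSupport fun x : Euc N =>
      (‖x - x₀‖ ^ 2) ^ (-p) * (- deriv H (‖x - x₀‖ ^ 2)) := hdHS.neg.mul_left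
  have hint : IntegrableOn (fun x => (‖x - x₀‖ ^ 2) ^ (-p) * (- deriv H (‖x - x₀‖ ^ 2)) *
        (‖x - x₀‖ ^ 2 * ‖G x‖ ^ 2)) Ω := by
    simp only [← mul_assoc]
    exact hu.integrableOn_mul_norm_sq (b := fun x => (‖x - x₀‖ ^ 2) ^ (-p) *
      (- deriv H (‖x - x₀‖ ^ 2)) * ‖x - x₀‖ ^ 2) (by fun_prop) hκS.mul_right
  have hnn2 : ∀ x, 0 ≤ a⁻¹ * ((‖x - x₀‖ ^ 2) ^ (-p) * (- deriv H (‖x - x₀‖ ^ 2)) *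
        (‖x - x₀‖ ^ 2 * ‖G x‖ ^ 2)) := fun x => mul_nonneg (inv_pos.2 ha).le
    (mul_nonneg (mul_nonneg (Real.rpow_nonneg (sq_nonneg _) _)
      (neg_nonneg.2 (hH.deriv_nonpos _))) (by positivity))
  rw [← ofReal_integral_eq_lintegral_ofReal hfu (ae_of_all _ hnn),
    ← ofReal_integral_eq_lintegral_ofReal (hint.const_mul a⁻¹) (ae_of_all _ hnn2),
    ← ENNReal.ofReal_add (integral_nonneg hnn) (integral_nonneg hnn2), integral_const_mul]
  obtain ⟨ε, hε, hε0⟩ : ∃ ε : ℕ → ℝ, (∀ n, 0 < ε n) ∧ Tendsto ε atTop (𝓝 0) :=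
    ⟨fun n => 1 / ((n : ℝ) + 1), fun n => by positivity, tendsto_one_div_add_atTop_nhds_zero_nat⟩
  have hcn : ∀ n, Continuous fun x : Euc N =>
      (‖x - x₀‖ ^ 2 + ε n) ^ (-p) * H (‖x - x₀‖ ^ 2) := fun n =>
    (contDiff_add_rpow_mul hH.contDiff (hε n) (-p) x₀).continuous
  refine lintegral_le_of_ae_tendsto (F := fun n x => ENNReal.ofReal
    (‖G x‖ ^ 2 * ((‖x - x₀‖ ^ 2 + ε n) ^ (-p) * H (‖x - x₀‖ ^ 2)))) (fun n => ?_) ?_ fun n => ?_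
  · exact ((hGm.norm.pow 2).mul (hcn n).aestronglyMeasurable).aemeasurable.ennreal_ofReal
  -- The centre must be excluded: for p > 0 the convention `0 ^ (-p) = 0` breaks the convergence
  -- there.
  · filter_upwards [ae_ne_point (by omega) x₀ Ω] with x hx
    have ht : 0 < ‖x - x₀‖ ^ 2 := pow_pos (norm_pos_iff.2 (sub_ne_zero.2 hx)) 2
    refine ENNReal.tendsto_ofReal (Tendsto.const_mul _ (Tendsto.mul_const _ ?_))
    have h1 : Tendsto (fun n => ‖x - x₀‖ ^ 2 + ε n) atTop (𝓝 (‖x - x₀‖ ^ 2)) := by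
      simpa using hε0.const_add (‖x - x₀‖ ^ 2)
    exact h1.rpow_const (Or.inl ht.ne')
  · have hHS : HasCompactSupport fun x : Euc N => H (‖x - x₀‖ ^ 2) :=
      hasCompactSupport_comp_normSq x₀ (R := ρ₂) fun x hx => hH.eq_zero _ hx
    have hi := hu.integrableOn_mul_norm_sq (hcn n) hHS.mul_left
    simp only [mul_comm _ (‖G _‖ ^ 2)] at hi
    rw [← ofReal_integral_eq_lintegral_ofReal hi (ae_of_all _ fun x =>
      mul_nonneg (sq_nonneg _) (mul_nonneg (Real.rpow_nonneg (by have := hε n; positivity) _)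
        (hH.nonneg _)))]
    exact ENNReal.ofReal_le_ofReal
      (hu.regularized_energy_le hN hf hp hr₀ hσ0 hσ ha hap hH hρ hfu (hε n))

end Cutoff

/-! ### The optimal cutoff and its smooth approximation. -/

/-- The function `t ↦ c ^ (-a) - ρ₂ ^ (-a)`, where `c` is the point of `[ρ₁, ρ₂]` nearest to `t`. -/
def truncatedPower (a ρ₁ ρ₂ t : ℝ) : ℝ := (min (max t ρ₁) ρ₂) ^ (-a) - ρ₂ ^ (-a)

theorem integral_mul_rpow_neg_sub_one {a c d : ℝ} (ha : 0 < a) (hc : 0 < c) (hd : 0 < d) :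
    ∫ s in c..d, a * s ^ (-a - 1) = c ^ (-a) - d ^ (-a) := by
  rw [intervalIntegral.integral_const_mul, integral_rpow (Or.inr ⟨by linarith, notMem_uIcc_of_lt hc hd⟩),
    show -a - 1 + 1 = -a by ring]
  field_simp
  ring

/-- The ideal cutoff is ∫ a s^(-a-1) ds over the part of (ρ₁, ρ₂) to the right of t. Multiplying
this density by smooth θₙ ≤ 1 that vanish off (ρ₁, ρ₂) and tend to 1 inside gives smooth cutoffs,
bounded by the ideal one and with slope no steeper. -/
theorem exists_cutoff_seq {a ρ₁ ρ₂ : ℝ} (ha : 0 < a) (h₁ : 0 < ρ₁) (h₁₂ : ρ₁ < ρ₂) :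
    ∃ H : ℕ → ℝ → ℝ, (∀ n, IsCutoff (H n) ρ₁ ρ₂) ∧
      (∀ n t, H n t ≤ truncatedPower a ρ₁ ρ₂ t) ∧
      (∀ n, ∀ t ∈ Ioo ρ₁ ρ₂, - deriv (H n) t ≤ a * t ^ (-a - 1)) ∧
      ∀ t, Tendsto (fun n => H n t) atTop (𝓝 (truncatedPower a ρ₁ ρ₂ t)) := by
  obtain ⟨θ, hθ⟩ : ∃ θ : ℕ → ℝ → ℝ, θ = fun (n : ℕ) (s : ℝ) =>
    Real.smoothTransition (n * (s - ρ₁)) * Real.smoothTransition (n * (ρ₂ - s)) := ⟨_, rfl⟩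
  have hθ0 : ∀ n s, 0 ≤ θ n s := fun n s => by
    rw [hθ]
    exact mul_nonneg (Real.smoothTransition.nonneg _) (Real.smoothTransition.nonneg _)
  have hθ1 : ∀ n s, θ n s ≤ 1 := fun n s => by
    rw [hθ]
    exact mul_le_one₀ (Real.smoothTransition.le_one _) (Real.smoothTransition.nonneg _)
      (Real.smoothTransition.le_one _)
  have hθz : ∀ n s, s ∉ Ioo ρ₁ ρ₂ → θ n s = 0 := by
    intro n s hs
    have hn : (0 : ℝ) ≤ n := n.cast_nonneg
    rw [hθ]
    by_cases h : ρ₁ < s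
    · have : ρ₂ ≤ s := not_lt.1 fun h2 => hs ⟨h, h2⟩
      simp only
      rw [Real.smoothTransition.zero_of_nonpos
        (mul_nonpos_of_nonneg_of_nonpos hn (sub_nonpos.2 this)), mul_zero]
    · simp only
      rw [Real.smoothTransition.zero_of_nonpos
        (mul_nonpos_of_nonneg_of_nonpos hn (sub_nonpos.2 (not_lt.1 h))), zero_mul]
  have hθlim : ∀ s ∈ Ioo ρ₁ ρ₂, Tendsto (fun n => θ n s) atTop (𝓝 1) := by
    intro s hs
    have key : ∀ y : ℝ, 0 < y →
        Tendsto (fun n : ℕ => Real.smoothTransition (n * y)) atTop (𝓝 1) := by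
      intro y hy
      refine tendsto_const_nhds.congr' ?_
      filter_upwards [(tendsto_natCast_atTop_atTop.atTop_mul_const hy).eventually_ge_atTop 1]
        with n hn using (Real.smoothTransition.one_of_one_le hn).symm
    rw [hθ]
    simpa using (key _ (sub_pos.2 hs.1)).mul (key _ (sub_pos.2 hs.2))
  have hθs : ∀ n, ContDiff ℝ (⊤ : ℕ∞) (θ n) := by
    intro n
    rw [hθ]
    exact (Real.smoothTransition.contDiff.comp
      (contDiff_const.mul (contDiff_id.sub contDiff_const))).mul
      (Real.smoothTransition.contDiff.comp (contDiff_const.mul (contDiff_const.sub contDiff_id)))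
  obtain ⟨w, hw⟩ : ∃ w : ℕ → ℝ → ℝ, w = fun n s => a * s ^ (-a - 1) * θ n s := ⟨_, rfl⟩
  have hws : ∀ n, ContDiff ℝ (⊤ : ℕ∞) (w n) := by
    intro n
    rw [hw, contDiff_iff_contDiffAt]
    intro s
    by_cases hs : 0 < s
    · exact (contDiffAt_const.mul (Real.contDiffAt_rpow_const_of_ne hs.ne')).mul (hθs n).contDiffAt
    · refine (contDiffAt_const (c := (0 : ℝ))).congr_of_eventuallyEq ?_
      filter_upwards [Iio_mem_nhds ((not_lt.1 hs).trans_lt h₁)] with y hy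
      rw [hθz n y fun h => absurd h.1 (not_lt.2 (le_of_lt hy)), mul_zero]
  have hwz : ∀ n s, s ∉ Ioo ρ₁ ρ₂ → w n s = 0 := fun n s hs => by simp [hw, hθz n s hs]
  have hw0 : ∀ n s, 0 ≤ w n s := by
    intro n s
    by_cases hs : s ∈ Ioo ρ₁ ρ₂
    · rw [hw]
      exact mul_nonneg (mul_nonneg ha.le (Real.rpow_nonneg (h₁.trans hs.1).le _)) (hθ0 n s)
    · rw [hwz n s hs]
  have hwle : ∀ n s, 0 < s → w n s ≤ a * s ^ (-a - 1) := by
    intro n s hs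
    rw [hw]
    exact mul_le_of_le_one_right (mul_nonneg ha.le (Real.rpow_nonneg hs.le _)) (hθ1 n s)
  have hder : ∀ n t, HasDerivAt (fun t => ∫ s in t..ρ₂, w n s) (- w n t) t := by
    intro n t
    simp only [intervalIntegral.integral_symm ρ₂]
    exact ((hws n).continuous.integral_hasStrictDerivAt ρ₂ t).hasDerivAt.neg
  have hderiv : ∀ n t, deriv (fun t => ∫ s in t..ρ₂, w n s) t = - w n t := fun n t =>
    (hder n t).deriv
  -- the point of the interval nearest to `t`
  have hclamp : ∀ n t, ∫ s in t..ρ₂, w n s = ∫ s in (min (max t ρ₁) ρ₂)..ρ₂, w n s := by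
    intro n t
    rw [← intervalIntegral.integral_add_adjacent_intervals (b := min (max t ρ₁) ρ₂)
      ((hws n).continuous.intervalIntegrable _ _) ((hws n).continuous.intervalIntegrable _ _)]
    refine add_eq_right.2 (intervalIntegral.integral_zero_ae (ae_of_all _ fun s hs => hwz n s ?_))
    rintro ⟨hs1, hs2⟩
    rw [mem_uIoc] at hs
    rcases hs with ⟨h3, h4⟩ | ⟨h3, h4⟩
    · rcases le_min_iff.1 h4 with ⟨h5, -⟩
      rcases le_max_iff.1 h5 with h6 | h6 <;> linarith
    · rcases min_lt_iff.1 h3 with h5 | h5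
      · rcases max_lt_iff.1 h5 with ⟨h6, -⟩
        linarith
      · linarith
  have hcpos : ∀ t, 0 < min (max t ρ₁) ρ₂ := fun t =>
    lt_min (h₁.trans_le (le_max_right _ _)) (h₁.trans h₁₂)
  have hcont : ∀ t, ContinuousOn (fun s : ℝ => a * s ^ (-a - 1)) (uIcc (min (max t ρ₁) ρ₂) ρ₂) := by
    intro t s hs
    rw [uIcc_of_le (min_le_right _ _)] at hs
    exact (continuousAt_const.mul (Real.continuousAt_rpow_const _ _
      (Or.inl ((hcpos t).trans_le hs.1).ne'))).continuousWithinAt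
  refine ⟨fun n t => ∫ s in t..ρ₂, w n s, fun n => ⟨h₁, ?_, ?_, ?_, ?_, ?_⟩, ?_, ?_, ?_⟩
  · rw [contDiff_infty_iff_deriv]
    refine ⟨fun t => (hder n t).differentiableAt, ?_⟩
    have : deriv (fun t => ∫ s in t..ρ₂, w n s) = fun t => - w n t := funext (hderiv n)
    rw [this]
    exact (hws n).neg
  · intro t
    simp only [hclamp n t]
    exact intervalIntegral.integral_nonneg (min_le_right _ _) fun s _ => hw0 n s
  · intro t ht
    simp only [hclamp n t]
    rw [min_eq_right (ht.trans (le_max_left _ _)), intervalIntegral.integral_same]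
  · intro t
    rw [hderiv]
    exact neg_nonpos.2 (hw0 n t)
  · intro t ht
    rw [hderiv, hwz n t ht, neg_zero]
  · intro n t
    simp only [hclamp n t]
    rw [truncatedPower, ← integral_mul_rpow_neg_sub_one ha (hcpos t) (h₁.trans h₁₂)]
    refine intervalIntegral.integral_mono_on (min_le_right _ _)
      ((hws n).continuous.intervalIntegrable _ _) (hcont t).intervalIntegrable fun s hs => ?_
    exact hwle n s ((hcpos t).trans_le hs.1)
  · intro n t ht
    rw [hderiv, neg_neg]
    exact hwle n t (h₁.trans ht.1)
  · intro t
    simp only [hclamp _ t]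
    rw [truncatedPower, ← integral_mul_rpow_neg_sub_one ha (hcpos t) (h₁.trans h₁₂)]
    refine intervalIntegral.tendsto_integral_filter_of_dominated_convergence
      (fun s => a * s ^ (-a - 1)) (Eventually.of_forall fun n =>
        (hws n).continuous.aestronglyMeasurable) (Eventually.of_forall fun n =>
        ae_of_all _ fun s hs => ?_) (hcont t).intervalIntegrable ?_
    · rw [uIoc_of_le (min_le_right _ _)] at hs
      rw [Real.norm_of_nonneg (hw0 n s)]
      exact hwle n s ((hcpos t).trans hs.1)
    · have hne : ∀ᵐ s : ℝ, s ≠ ρ₂ := compl_mem_ae_iff.2 (measure_singleton ρ₂)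
      filter_upwards [hne] with s hs2 hs
      rw [uIoc_of_le (min_le_right _ _)] at hs
      have hs1 : ρ₁ < s :=
        (le_min (le_max_right _ _) h₁₂.le).trans_lt hs.1
      have := (hθlim s ⟨hs1, lt_of_le_of_ne hs.2 hs2⟩).const_mul (a * s ^ (-a - 1))
      simpa [hw] using this

/-! ### The energy inequality for the truncated power. -/

section Key

variable {Ω : Opens (Euc N)} {f u : Euc N → ℝ} {G : Euc N → Euc N} {x₀ : Euc N}
  {r₀ σ a p r₁ r₂ : ℝ}

/-- Since -H' ≤ a t^(-a-1), the factor a⁻¹ t (-H') is at most t^(-a), which is the weight on the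
annulus. -/
theorem IsWeakSolution.lintegral_truncatedPower_le (hu : IsWeakSolution Ω f u G) (hN : 2 ≤ N)
    (hf : IntegrableOn f Ω) (hp : 2 * p = (N : ℝ) - 2) (hr₀ : 0 < r₀) (hσ0 : 0 < σ)
    (hσ : ENNReal.ofReal σ ≤
      (⨅ r ∈ Ioo (0 : ℝ) r₀, ENNReal.ofReal (r ^ 2) * sphericalEigenvalue Ω x₀ r))
    (ha : 0 < a) (hap : a * (a + 2 * p) = σ) (hr₁ : 0 < r₁) (hr₁₂ : r₁ < r₂) (hr₂ : r₂ ≤ r₀) :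
    ∫⁻ x in Ω, ENNReal.ofReal (‖G x‖ ^ 2 *
        ((‖x - x₀‖ ^ 2) ^ (-p) * truncatedPower a (r₁ ^ 2) (r₂ ^ 2) (‖x - x₀‖ ^ 2))) ≤
      (∫⁻ x in Ω, ENNReal.ofReal (|u x * f x| *
        ((‖x - x₀‖ ^ 2) ^ (-p) * truncatedPower a (r₁ ^ 2) (r₂ ^ 2) (‖x - x₀‖ ^ 2)))) +
      ∫⁻ x in (Metric.ball x₀ r₂ \ Metric.ball x₀ r₁) ∩ Ω,
        ENNReal.ofReal (‖G x‖ ^ 2 * ((‖x - x₀‖ ^ 2) ^ (-p) * (‖x - x₀‖ ^ 2) ^ (-a))) := by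
  have hsq : r₁ ^ 2 < r₂ ^ 2 := pow_lt_pow_left₀ hr₁₂ hr₁.le two_ne_zero
  obtain ⟨H, hH, hHle, hHd, hHlim⟩ := exists_cutoff_seq ha (pow_pos hr₁ 2) hsq
  have hGm := hu.memLp_grad.aestronglyMeasurable
  refine lintegral_le_of_ae_tendsto (F := fun n x => ENNReal.ofReal
    (‖G x‖ ^ 2 * ((‖x - x₀‖ ^ 2) ^ (-p) * H n (‖x - x₀‖ ^ 2)))) (fun n => ?_)
    (ae_of_all _ fun x => ENNReal.tendsto_ofReal (((hHlim _).const_mul _).const_mul _))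
    fun n => ?_
  · have : Measurable fun x : Euc N => (‖x - x₀‖ ^ 2) ^ (-p) * H n (‖x - x₀‖ ^ 2) := by
      have := (hH n).contDiff.continuous.measurable
      fun_prop
    exact ((hGm.norm.pow 2).mul this.aestronglyMeasurable).aemeasurable.ennreal_ofReal
  · refine (hu.lintegral_energy_le hN hf hp hr₀ hσ0 hσ ha hap (hH n)
      (pow_le_pow_left₀ (hr₁.trans hr₁₂).le hr₂ 2)).trans (add_le_add ?_ ?_)
    · refine lintegral_mono fun x => ENNReal.ofReal_le_ofReal ?_
      exact mul_le_mul_of_nonneg_left (mul_le_mul_of_nonneg_left (hHle n _)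
        (Real.rpow_nonneg (sq_nonneg _) _)) (abs_nonneg _)
    · have hSm : MeasurableSet (Metric.ball x₀ r₂ \ Metric.ball x₀ r₁) :=
        measurableSet_ball.diff measurableSet_ball
      rw [← Measure.restrict_restrict hSm, ← lintegral_indicator hSm]
      refine lintegral_mono fun x => ?_
      by_cases hx : ‖x - x₀‖ ^ 2 ∈ Ioo (r₁ ^ 2) (r₂ ^ 2)
      · have hxS : x ∈ Metric.ball x₀ r₂ \ Metric.ball x₀ r₁ := by
          rw [Set.mem_sdiff, mem_ball_iff_norm, mem_ball_iff_norm, not_lt]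
          exact ⟨lt_of_pow_lt_pow_left₀ 2 (hr₁.trans hr₁₂).le hx.2,
            (lt_of_pow_lt_pow_left₀ 2 (norm_nonneg _) hx.1).le⟩
        rw [indicator_of_mem hxS]
        refine ENNReal.ofReal_le_ofReal ?_
        have ht : 0 < ‖x - x₀‖ ^ 2 := (pow_pos hr₁ 2).trans hx.1
        obtain ⟨t, htt⟩ : ∃ t, t = ‖x - x₀‖ ^ 2 := ⟨_, rfl⟩
        have hd := hHd n _ hx
        rw [← htt] at hd ht ⊢
        calc a⁻¹ * (t ^ (-p) * (- deriv (H n) t) * (t * ‖G x‖ ^ 2))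
            ≤ a⁻¹ * (t ^ (-p) * (a * t ^ (-a - 1)) * (t * ‖G x‖ ^ 2)) := by
              have := Real.rpow_nonneg ht.le (-p)
              gcongr
          _ = ‖G x‖ ^ 2 * (t ^ (-p) * t ^ (-a)) := by
              rw [Real.rpow_sub_one ht.ne']
              field_simp
      · rw [(hH n).deriv_eq_zero _ hx]
        simp

end Key

theorem sq_rpow {x : ℝ} (hx : 0 ≤ x) (z : ℝ) : (x ^ 2) ^ z = x ^ (2 * z) := by
  rw [← Real.rpow_natCast_mul hx]
  norm_num

/-- Passes from the variable |x - x₀|², used for smoothness at the centre, back to the radius; the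
exponent a = β/2 becomes β. -/
theorem truncatedPower_sq (a : ℝ) {r₁ r₂ t : ℝ} (h₁ : 0 ≤ r₁) (h₂ : 0 ≤ r₂) (ht : 0 ≤ t) :
    truncatedPower a (r₁ ^ 2) (r₂ ^ 2) (t ^ 2) = truncatedPower (2 * a) r₁ r₂ t := by
  have hmax : max (t ^ 2) (r₁ ^ 2) = (max t r₁) ^ 2 := by
    rcases le_total t r₁ with h | h
    · rw [max_eq_right h, max_eq_right (pow_le_pow_left₀ ht h 2)]
    · rw [max_eq_left h, max_eq_left (pow_le_pow_left₀ h₁ h 2)]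
  have h0 : 0 ≤ max t r₁ := le_max_of_le_left ht
  have hmin : min ((max t r₁) ^ 2) (r₂ ^ 2) = (min (max t r₁) r₂) ^ 2 := by
    rcases le_total (max t r₁) r₂ with h | h
    · rw [min_eq_left h, min_eq_left (pow_le_pow_left₀ h0 h 2)]
    · rw [min_eq_right h, min_eq_right (pow_le_pow_left₀ h₂ h 2)]
  rw [truncatedPower, hmax, hmin, sq_rpow (le_min h0 h₂), sq_rpow h₂, truncatedPower,
    show 2 * -a = -(2 * a) by ring]

theorem truncatedPower_nonneg {β r₁ r₂ : ℝ} (hβ : 0 < β) (h₁ : 0 < r₁) (h₂ : r₁ < r₂) (t : ℝ) :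
    0 ≤ truncatedPower β r₁ r₂ t :=
  sub_nonneg.2 (Real.rpow_le_rpow_of_nonpos (lt_min (h₁.trans_le (le_max_right _ _)) (h₁.trans h₂))
    (min_le_right _ _) (by linarith))

theorem ofReal_truncatedPower_eq_lintegral {β r₁ r₂ : ℝ} (hβ : 0 < β) (h₁ : 0 < r₁) (h₂ : r₁ < r₂)
    (t : ℝ) :
    ENNReal.ofReal (truncatedPower β r₁ r₂ t) =
      ∫⁻ s in Ioo (min (max t r₁) r₂) r₂, ENNReal.ofReal (β * s ^ (-β - 1)) := by
  have hc : 0 < min (max t r₁) r₂ := lt_min (h₁.trans_le (le_max_right _ _)) (h₁.trans h₂)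
  have hcont : ContinuousOn (fun s : ℝ => β * s ^ (-β - 1)) (uIcc (min (max t r₁) r₂) r₂) := by
    intro s hs
    rw [uIcc_of_le (min_le_right _ _)] at hs
    exact (continuousAt_const.mul (Real.continuousAt_rpow_const _ _
      (Or.inl (hc.trans_le hs.1).ne'))).continuousWithinAt
  rw [truncatedPower, ← integral_mul_rpow_neg_sub_one hβ hc (h₁.trans h₂),
    intervalIntegral.integral_of_le (min_le_right _ _), Measure.restrict_congr_set Ioo_ae_eq_Ioc]
  refine ofReal_integral_eq_lintegral_ofReal
    ((intervalIntegrable_iff_integrableOn_Ioc_of_le (min_le_right _ _)).1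
      hcont.intervalIntegrable) ?_
  filter_upwards [ae_restrict_mem measurableSet_Ioc] with s hs
  exact mul_nonneg hβ.le (Real.rpow_nonneg (hc.trans hs.1).le _)

/-! ### Monotonicity and the energy bound. -/

section Final

variable {Ω : Opens (Euc N)} {f u : Euc N → ℝ} {G : Euc N → Euc N} {x₀ : Euc N}
  {r₀ σ β r₁ r₂ : ℝ}

/-- Layer-cake formula: the truncated power at |x - x₀| is the integral of β s^(-β-1) over those s
in (r₁, r₂) whose ball B(x₀, s) contains x. Tonelli's theorem then produces ψ(s). -/
theorem lintegral_truncatedPower_eq_psi (hβ : 0 < β) (h₁ : 0 < r₁) (h₂ : r₁ < r₂)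
    (hum : AEStronglyMeasurable u (volume.restrict (Ω : Set (Euc N))))
    (hfm : AEStronglyMeasurable f (volume.restrict (Ω : Set (Euc N)))) :
    ∫⁻ x in Ω, ENNReal.ofReal (|u x * f x| * ‖x - x₀‖ ^ (2 - (N : ℝ))) *
        ENNReal.ofReal (truncatedPower β r₁ r₂ ‖x - x₀‖) =
      ENNReal.ofReal β * ∫⁻ s in Ioo r₁ r₂, psi Ω x₀ u f s * ENNReal.ofReal (s ^ (-1 - β)) := by
  have hF : AEMeasurable (fun x => ENNReal.ofReal (|u x * f x| * ‖x - x₀‖ ^ (2 - (N : ℝ))))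
      (volume.restrict (Ω : Set (Euc N))) := by
    have h3 : Measurable fun x : Euc N => ‖x - x₀‖ ^ (2 - (N : ℝ)) := by fun_prop
    exact ((hum.mul hfm).norm.aemeasurable.mul h3.aemeasurable).ennreal_ofReal
  obtain ⟨F, hFdef⟩ : ∃ F : Euc N → ℝ≥0∞, F =
      fun x => ENNReal.ofReal (|u x * f x| * ‖x - x₀‖ ^ (2 - (N : ℝ))) := ⟨_, rfl⟩
  have e1 : ∀ x, F x * ENNReal.ofReal (truncatedPower β r₁ r₂ ‖x - x₀‖) =
      ∫⁻ s in Ioo r₁ r₂, F x * (Ioi ‖x - x₀‖).indicator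
        (fun s => ENNReal.ofReal (β * s ^ (-β - 1))) s := by
    intro x
    rw [lintegral_const_mul _ ((by fun_prop : Measurable fun s : ℝ =>
        ENNReal.ofReal (β * s ^ (-β - 1))).indicator measurableSet_Ioi),
      lintegral_indicator measurableSet_Ioi, Measure.restrict_restrict measurableSet_Ioi,
      ofReal_truncatedPower_eq_lintegral hβ h₁ h₂]
    congr 3
    ext s
    simp only [mem_Ioo, mem_inter_iff, mem_Ioi, min_lt_iff, max_lt_iff]
    constructor
    · rintro ⟨h | h, h3⟩
      · exact ⟨h.1, h.2, h3⟩
      · exact absurd h (not_lt.2 h3.le)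
    · rintro ⟨h3, h4, h5⟩
      exact ⟨Or.inl ⟨h3, h4⟩, h5⟩
  have e2 : ∀ s ∈ Ioo r₁ r₂, ∫⁻ x in Ω, F x * (Ioi ‖x - x₀‖).indicator
        (fun s => ENNReal.ofReal (β * s ^ (-β - 1))) s =
      ENNReal.ofReal β * (psi Ω x₀ u f s * ENNReal.ofReal (s ^ (-1 - β))) := by
    intro s hs
    have h3 : ∀ x, F x * (Ioi ‖x - x₀‖).indicator
        (fun s => ENNReal.ofReal (β * s ^ (-β - 1))) s =
        (Metric.ball x₀ s).indicator (fun x => F x * ENNReal.ofReal (β * s ^ (-β - 1))) x := by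
      intro x
      by_cases hx : ‖x - x₀‖ < s
      · rw [indicator_of_mem (mem_Ioi.2 hx), indicator_of_mem (mem_ball_iff_norm.2 hx)]
      · rw [indicator_of_notMem (fun h => hx (mem_Ioi.1 h)), indicator_of_notMem
          (fun h => hx (mem_ball_iff_norm.1 h)), mul_zero]
    simp only [h3]
    rw [lintegral_indicator measurableSet_ball, Measure.restrict_restrict measurableSet_ball,
      lintegral_mul_const' _ _ ENNReal.ofReal_ne_top, ENNReal.ofReal_mul hβ.le, psi, hFdef,
      show -β - 1 = -1 - β by ring]
    ring
  rw [← lintegral_const_mul' _ _ ENNReal.ofReal_ne_top]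
  change ∫⁻ x in Ω, ENNReal.ofReal (|u x * f x| * ‖x - x₀‖ ^ (2 - (N : ℝ))) * _ = _
  rw [← setLIntegral_congr_fun measurableSet_Ioo e2]
  rw [← lintegral_lintegral_swap]
  · refine lintegral_congr fun x => ?_
    rw [← e1, hFdef]
  · rw [← hFdef] at hF
    refine AEMeasurable.mul hF.comp_fst ?_
    have : (Function.uncurry fun (x : Euc N) (s : ℝ) => (Ioi ‖x - x₀‖).indicator
        (fun s => ENNReal.ofReal (β * s ^ (-β - 1))) s) =
        {z : Euc N × ℝ | ‖z.1 - x₀‖ < z.2}.indicator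
          fun z => ENNReal.ofReal (β * z.2 ^ (-β - 1)) := by
      ext z
      rfl
    refine Measurable.aemeasurable ?_
    change Measurable (Function.uncurry fun (x : Euc N) (s : ℝ) => (Ioi ‖x - x₀‖).indicator
        (fun s => ENNReal.ofReal (β * s ^ (-β - 1))) s)
    rw [this]
    exact Measurable.indicator (by fun_prop) (measurableSet_lt (by fun_prop) (by fun_prop))

theorem IsWeakSolution.weighted_truncatedPower_le (hu : IsWeakSolution Ω f u G) (hN : 2 ≤ N)
    (hf : IntegrableOn f Ω) (hr₀ : 0 < r₀) (hσ0 : 0 < σ)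
    (hσ : ENNReal.ofReal σ ≤
      (⨅ r ∈ Ioo (0 : ℝ) r₀, ENNReal.ofReal (r ^ 2) * sphericalEigenvalue Ω x₀ r))
    (hβ : 0 < β) (hβσ : β * (β + 2 * ((N : ℝ) - 2)) = 4 * σ)
    (hr₁ : 0 < r₁) (hr₁₂ : r₁ < r₂) (hr₂ : r₂ ≤ r₀) :
    ∫⁻ x in Ω, ENNReal.ofReal (‖G x‖ ^ 2 * ‖x - x₀‖ ^ (2 - (N : ℝ))) *
        ENNReal.ofReal (truncatedPower β r₁ r₂ ‖x - x₀‖) ≤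
      (∫⁻ x in Ω, ENNReal.ofReal (|u x * f x| * ‖x - x₀‖ ^ (2 - (N : ℝ))) *
        ENNReal.ofReal (truncatedPower β r₁ r₂ ‖x - x₀‖)) +
      ∫⁻ x in (Metric.ball x₀ r₂ \ Metric.ball x₀ r₁) ∩ Ω,
        ENNReal.ofReal (‖G x‖ ^ 2 * ‖x - x₀‖ ^ (2 - (N : ℝ))) *
          ENNReal.ofReal (‖x - x₀‖ ^ (-β)) := by
  have h := hu.lintegral_truncatedPower_le (x₀ := x₀) (p := ((N : ℝ) - 2) / 2) (a := β / 2) hN hf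
    (by ring) hr₀ hσ0 hσ (by linarith) (by linarith) hr₁ hr₁₂ hr₂
  simp only [truncatedPower_sq _ hr₁.le (hr₁.trans hr₁₂).le (norm_nonneg _),
    sq_rpow (norm_nonneg _), show 2 * -(((N : ℝ) - 2) / 2) = 2 - N by ring,
    show 2 * (β / 2) = β by ring, show 2 * -(β / 2) = -β by ring, ← mul_assoc] at h
  have e : ∀ (w : ℝ) (x : Euc N) (v : ℝ), 0 ≤ w →
      ENNReal.ofReal (w * ‖x - x₀‖ ^ (2 - (N : ℝ)) * v) =
      ENNReal.ofReal (w * ‖x - x₀‖ ^ (2 - (N : ℝ))) * ENNReal.ofReal v := fun w x v hw =>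
    ENNReal.ofReal_mul (mul_nonneg hw (Real.rpow_nonneg (norm_nonneg _) _))
  simpa only [e _ _ _ (sq_nonneg _), e _ _ _ (abs_nonneg _)] using h

theorem lintegral_annulus_le (hN : 2 ≤ N) (hβ : 0 < β) (hr₁ : 0 < r₁) :
    ∫⁻ x in (Metric.ball x₀ r₂ \ Metric.ball x₀ r₁) ∩ Ω,
        ENNReal.ofReal (‖G x‖ ^ 2 * ‖x - x₀‖ ^ (2 - (N : ℝ))) * ENNReal.ofReal (‖x - x₀‖ ^ (-β)) ≤
      ENNReal.ofReal (r₁ ^ (2 - (N : ℝ) - β)) * eLpNorm G 2 (volume.restrict (Ω : Set (Euc N))) ^ 2 := by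
  have hN2 : (2 : ℝ) ≤ N := by exact_mod_cast hN
  have hsq : eLpNorm G 2 (volume.restrict (Ω : Set (Euc N))) ^ 2 =
      ∫⁻ x in Ω, ENNReal.ofReal (‖G x‖ ^ 2) := by
    have h := eLpNorm_nnreal_pow_eq_lintegral (f := G) (p := 2)
      (μ := volume.restrict (Ω : Set (Euc N))) two_ne_zero
    simp only [ENNReal.coe_ofNat, NNReal.coe_ofNat, ENNReal.rpow_ofNat] at h
    rw [h]
    refine lintegral_congr fun x => ?_
    rw [ENNReal.ofReal_pow (norm_nonneg _), ofReal_norm]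
  have hSm : MeasurableSet (Metric.ball x₀ r₂ \ Metric.ball x₀ r₁) :=
    measurableSet_ball.diff measurableSet_ball
  rw [hsq, ← lintegral_const_mul' _ _ ENNReal.ofReal_ne_top]
  refine (setLIntegral_mono_ae' (hSm.inter Ω.isOpen.measurableSet)
    (ae_of_all _ fun x hx => ?_)).trans (lintegral_mono_set inter_subset_right)
  have hx1 : r₁ ≤ ‖x - x₀‖ := by
    have := hx.1.2
    rwa [mem_ball_iff_norm, not_lt] at this
  have hx0 : 0 < ‖x - x₀‖ := hr₁.trans_le hx1
  rw [← ENNReal.ofReal_mul (by positivity), ← ENNReal.ofReal_mul (by positivity), mul_assoc,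
    ← Real.rpow_add hx0, mul_comm (‖G x‖ ^ 2)]
  refine ENNReal.ofReal_le_ofReal (mul_le_mul_of_nonneg_right ?_ (sq_nonneg _))
  exact Real.rpow_le_rpow_of_nonpos hr₁ hx1 (by linarith)

/-- After adding r₂^(-β), the truncated power equals r₁^(-β) on the inner ball and |x - x₀|^(-β) on
the annulus. So the annulus integral occurs on both sides and cancels. -/
theorem IsWeakSolution.rpow_mul_weightedEnergy_le (hu : IsWeakSolution Ω f u G) (hN : 2 ≤ N)
    (hf : IntegrableOn f Ω) (hr₀ : 0 < r₀) (hσ0 : 0 < σ)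
    (hσ : ENNReal.ofReal σ ≤
      (⨅ r ∈ Ioo (0 : ℝ) r₀, ENNReal.ofReal (r ^ 2) * sphericalEigenvalue Ω x₀ r))
    (hβ : 0 < β) (hβσ : β * (β + 2 * ((N : ℝ) - 2)) = 4 * σ)
    (hr₁ : 0 < r₁) (hr₁₂ : r₁ < r₂) (hr₂ : r₂ ≤ r₀) :
    ENNReal.ofReal (r₁ ^ (-β)) * weightedEnergy Ω x₀ G r₁ ≤
      ENNReal.ofReal (r₂ ^ (-β)) * weightedEnergy Ω x₀ G r₂ +
      ENNReal.ofReal β * ∫⁻ s in Ioo r₁ r₂, psi Ω x₀ u f s * ENNReal.ofReal (s ^ (-1 - β)) := by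
  have h := hu.weighted_truncatedPower_le hN hf hr₀ hσ0 hσ hβ hβσ hr₁ hr₁₂ hr₂
  rw [lintegral_truncatedPower_eq_psi hβ hr₁ hr₁₂ hu.memLp.aestronglyMeasurable
    hf.aestronglyMeasurable] at h
  -- Finiteness is what allows cancellation in `ℝ≥0∞`.
  have hX : ∫⁻ x in (Metric.ball x₀ r₂ \ Metric.ball x₀ r₁) ∩ Ω,
        ENNReal.ofReal (‖G x‖ ^ 2 * ‖x - x₀‖ ^ (2 - (N : ℝ))) *
          ENNReal.ofReal (‖x - x₀‖ ^ (-β)) ≠ ⊤ :=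
    ne_top_of_le_ne_top (ENNReal.mul_ne_top ENNReal.ofReal_ne_top
      (ENNReal.pow_ne_top hu.memLp_grad.eLpNorm_ne_top)) (lintegral_annulus_le hN hβ hr₁)
  have hSm : MeasurableSet (Metric.ball x₀ r₂ \ Metric.ball x₀ r₁) :=
    measurableSet_ball.diff measurableSet_ball
  have hr₂0 := hr₁.trans hr₁₂
  have hcF : ∀ x, 0 ≤ truncatedPower β r₁ r₂ ‖x - x₀‖ := fun x =>
    truncatedPower_nonneg hβ hr₁ hr₁₂ _
  have hsum : ENNReal.ofReal (r₁ ^ (-β)) * weightedEnergy Ω x₀ G r₁ +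
      ∫⁻ x in (Metric.ball x₀ r₂ \ Metric.ball x₀ r₁) ∩ Ω,
        ENNReal.ofReal (‖G x‖ ^ 2 * ‖x - x₀‖ ^ (2 - (N : ℝ))) *
          ENNReal.ofReal (‖x - x₀‖ ^ (-β)) ≤
      (∫⁻ x in Ω, ENNReal.ofReal (‖G x‖ ^ 2 * ‖x - x₀‖ ^ (2 - (N : ℝ))) *
        ENNReal.ofReal (truncatedPower β r₁ r₂ ‖x - x₀‖)) +
      ENNReal.ofReal (r₂ ^ (-β)) * weightedEnergy Ω x₀ G r₂ := by
    obtain ⟨K, hK⟩ : ∃ K : Euc N → ℝ≥0∞, K = fun x =>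
      ENNReal.ofReal (‖G x‖ ^ 2 * ‖x - x₀‖ ^ (2 - (N : ℝ))) *
        ENNReal.ofReal (truncatedPower β r₁ r₂ ‖x - x₀‖ + r₂ ^ (-β)) := ⟨_, rfl⟩
    have h1 : ENNReal.ofReal (r₁ ^ (-β)) * weightedEnergy Ω x₀ G r₁ =
        ∫⁻ x in Metric.ball x₀ r₁ ∩ Ω, K x := by
      rw [weightedEnergy, ← lintegral_const_mul' _ _ ENNReal.ofReal_ne_top]
      refine setLIntegral_congr_fun (measurableSet_ball.inter Ω.isOpen.measurableSet) fun x hx => ?_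
      have hx1 := mem_ball_iff_norm.1 hx.1
      simp only [hK, truncatedPower]
      rw [max_eq_right hx1.le, min_eq_left hr₁₂.le, sub_add_cancel, mul_comm]
    have h2 : ∫⁻ x in (Metric.ball x₀ r₂ \ Metric.ball x₀ r₁) ∩ Ω,
        ENNReal.ofReal (‖G x‖ ^ 2 * ‖x - x₀‖ ^ (2 - (N : ℝ))) *
          ENNReal.ofReal (‖x - x₀‖ ^ (-β)) =
        ∫⁻ x in (Metric.ball x₀ r₂ \ Metric.ball x₀ r₁) ∩ Ω, K x := by
      refine setLIntegral_congr_fun (hSm.inter Ω.isOpen.measurableSet) fun x hx => ?_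
      have hx1 : r₁ ≤ ‖x - x₀‖ := by
        have := hx.1.2
        rwa [mem_ball_iff_norm, not_lt] at this
      have hx2 := mem_ball_iff_norm.1 hx.1.1
      simp only [hK, truncatedPower]
      rw [max_eq_left hx1, min_eq_left hx2.le, sub_add_cancel]
    have hun : (Metric.ball x₀ r₁ ∩ Ω) ∪ ((Metric.ball x₀ r₂ \ Metric.ball x₀ r₁) ∩ Ω) =
        Metric.ball x₀ r₂ ∩ Ω := by
      rw [← union_inter_distrib_right, union_sdiff_cancel (Metric.ball_subset_ball hr₁₂.le)]
    have hdis : Disjoint (Metric.ball x₀ r₁ ∩ (Ω : Set (Euc N)))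
        ((Metric.ball x₀ r₂ \ Metric.ball x₀ r₁) ∩ Ω) :=
      (disjoint_sdiff_right).mono inter_subset_left inter_subset_left
    rw [h1, h2, ← lintegral_union (hSm.inter Ω.isOpen.measurableSet) hdis, hun]
    have h3 : ∀ x, K x = ENNReal.ofReal (‖G x‖ ^ 2 * ‖x - x₀‖ ^ (2 - (N : ℝ))) *
        ENNReal.ofReal (truncatedPower β r₁ r₂ ‖x - x₀‖) +
        ENNReal.ofReal (r₂ ^ (-β)) * ENNReal.ofReal (‖G x‖ ^ 2 * ‖x - x₀‖ ^ (2 - (N : ℝ))) := by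
      intro x
      rw [hK]
      simp only
      rw [ENNReal.ofReal_add (hcF x) (Real.rpow_nonneg hr₂0.le _), mul_add,
        mul_comm _ (ENNReal.ofReal (r₂ ^ (-β)))]
    simp only [h3]
    have hm : AEMeasurable (fun x => ENNReal.ofReal (r₂ ^ (-β)) *
        ENNReal.ofReal (‖G x‖ ^ 2 * ‖x - x₀‖ ^ (2 - (N : ℝ))))
        (volume.restrict (Metric.ball x₀ r₂ ∩ Ω)) := by
      have h4 : Measurable fun x : Euc N => ‖x - x₀‖ ^ (2 - (N : ℝ)) := by fun_prop
      have h5 := ((hu.memLp_grad.aestronglyMeasurable.norm.pow 2).aemeasurable.mul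
        h4.aemeasurable).ennreal_ofReal.const_mul (ENNReal.ofReal (r₂ ^ (-β)))
      exact h5.mono_measure (Measure.restrict_mono inter_subset_right le_rfl)
    rw [lintegral_add_right' _ hm, weightedEnergy, lintegral_const_mul' _ _ ENNReal.ofReal_ne_top]
    gcongr
    exact inter_subset_right
  have h6 := hsum.trans (add_le_add_left h _)
  refine (ENNReal.add_le_add_iff_right hX).1 (h6.trans (le_of_eq ?_))
  ring

/-- The truncated power equals its maximum k = r₁^(-β) - r₂^(-β) on the inner ball and vanishes
outside B(x₀, r₂); the estimate is divided by k. -/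
theorem IsWeakSolution.weightedEnergy_le (hu : IsWeakSolution Ω f u G) (hN : 2 ≤ N)
    (hf : IntegrableOn f Ω) (hr₀ : 0 < r₀) (hσ0 : 0 < σ)
    (hσ : ENNReal.ofReal σ ≤
      (⨅ r ∈ Ioo (0 : ℝ) r₀, ENNReal.ofReal (r ^ 2) * sphericalEigenvalue Ω x₀ r))
    (hβ : 0 < β) (hβσ : β * (β + 2 * ((N : ℝ) - 2)) = 4 * σ)
    (hr₁ : 0 < r₁) (hr₁₂ : r₁ < r₂) (hr₂ : r₂ ≤ r₀) :
    weightedEnergy Ω x₀ G r₁ ≤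
      ENNReal.ofReal (r₁ ^ (2 - (N : ℝ) - β) / (r₁ ^ (-β) - r₂ ^ (-β))) *
        eLpNorm G 2 (volume.restrict (Ω : Set (Euc N))) ^ 2 + psi Ω x₀ u f r₂ := by
  have h := hu.weighted_truncatedPower_le hN hf hr₀ hσ0 hσ hβ hβσ hr₁ hr₁₂ hr₂
  have hr₂0 := hr₁.trans hr₁₂
  obtain ⟨k, hk⟩ : ∃ k, k = r₁ ^ (-β) - r₂ ^ (-β) := ⟨_, rfl⟩
  have hk0 : 0 < k := by
    rw [hk, sub_pos]
    exact Real.rpow_lt_rpow_of_neg hr₁ hr₁₂ (by linarith)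
  have h1 : ENNReal.ofReal k * weightedEnergy Ω x₀ G r₁ ≤
      ∫⁻ x in Ω, ENNReal.ofReal (‖G x‖ ^ 2 * ‖x - x₀‖ ^ (2 - (N : ℝ))) *
        ENNReal.ofReal (truncatedPower β r₁ r₂ ‖x - x₀‖) := by
    rw [weightedEnergy, ← lintegral_const_mul' _ _ ENNReal.ofReal_ne_top]
    refine le_trans (le_of_eq ?_) (lintegral_mono_set (inter_subset_right (s := Metric.ball x₀ r₁)))
    refine setLIntegral_congr_fun (measurableSet_ball.inter Ω.isOpen.measurableSet) fun x hx => ?_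
    have hx1 := mem_ball_iff_norm.1 hx.1
    simp only [truncatedPower]
    rw [max_eq_right hx1.le, min_eq_left hr₁₂.le, hk, mul_comm]
  have h2 : ∫⁻ x in Ω, ENNReal.ofReal (|u x * f x| * ‖x - x₀‖ ^ (2 - (N : ℝ))) *
        ENNReal.ofReal (truncatedPower β r₁ r₂ ‖x - x₀‖) ≤
      ENNReal.ofReal k * psi Ω x₀ u f r₂ := by
    rw [psi, ← lintegral_const_mul' _ _ ENNReal.ofReal_ne_top,
      ← Measure.restrict_restrict measurableSet_ball, ← lintegral_indicator measurableSet_ball]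
    refine lintegral_mono fun x => ?_
    by_cases hx : x ∈ Metric.ball x₀ r₂
    · rw [indicator_of_mem hx, mul_comm (ENNReal.ofReal k)]
      refine mul_le_mul_right (ENNReal.ofReal_le_ofReal ?_) _
      rw [hk, truncatedPower]
      exact sub_le_sub_right (Real.rpow_le_rpow_of_nonpos hr₁
        (le_min (le_max_right _ _) hr₁₂.le) (by linarith)) _
    · have hx2 : r₂ ≤ ‖x - x₀‖ := by rwa [mem_ball_iff_norm, not_lt] at hx
      rw [indicator_of_notMem hx, truncatedPower, min_eq_right (hx2.trans (le_max_left _ _)),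
        sub_self, ENNReal.ofReal_zero, mul_zero]
  have h3 := h1.trans (h.trans (add_le_add h2 (lintegral_annulus_le hN hβ hr₁)))
  refine (ENNReal.mul_le_mul_iff_right (by simpa using hk0) ENNReal.ofReal_ne_top).1
    (h3.trans (le_of_eq ?_))
  rw [mul_add, ← mul_assoc, ← ENNReal.ofReal_mul hk0.le, ← hk, mul_div_cancel₀ _ hk0.ne', add_comm]

theorem betaExp_mem_Ioo (hN : 2 ≤ N) (hσ : σ ∈ Ioo (0 : ℝ) ((N : ℝ) - 1)) :
    betaExp N σ ∈ Ioo (0 : ℝ) 2 := by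
  have hN2 : (2 : ℝ) ≤ N := by exact_mod_cast hN
  refine ⟨sub_pos.2 (Real.lt_sqrt_of_sq_lt (by linarith [hσ.1])), ?_⟩
  -- The bound β < 2 amounts to (N-2)² + 4σ < N², that is, σ < N - 1.
  rw [betaExp, sub_lt_iff_lt_add, show (2 : ℝ) + ((N : ℝ) - 2) = N by ring,
    Real.sqrt_lt' (by linarith)]
  nlinarith [hσ.2]

theorem betaExp_mul (hσ : 0 ≤ σ) :
    betaExp N σ * (betaExp N σ + 2 * ((N : ℝ) - 2)) = 4 * σ := by
  have h := Real.sq_sqrt (show 0 ≤ ((N : ℝ) - 2) ^ 2 + 4 * σ by positivity)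
  rw [betaExp]
  linarith

theorem IsWeakSolution.monotoneOn (hu : IsWeakSolution Ω f u G) (hN : 2 ≤ N)
    (hf : IntegrableOn f Ω) (hσ0 : 0 < σ)
    (hσ : ENNReal.ofReal σ ≤
      (⨅ r ∈ Ioo (0 : ℝ) r₀, ENNReal.ofReal (r ^ 2) * sphericalEigenvalue Ω x₀ r))
    (hβ : 0 < β) (hβσ : β * (β + 2 * ((N : ℝ) - 2)) = 4 * σ) :
    MonotoneOn (monotoneQuantity Ω x₀ u f G β) (Ioo 0 r₀) := by
  intro r₁ h₁ r₂ h₂ h₁₂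
  rcases h₁₂.eq_or_lt with rfl | hlt
  · exact le_rfl
  have h := hu.rpow_mul_weightedEnergy_le hN hf (h₁.1.trans h₁.2) hσ0 hσ hβ hβσ h₁.1 hlt h₂.2.le
  have hI : (∫⁻ s in Ioo (0 : ℝ) r₁, psi Ω x₀ u f s * ENNReal.ofReal (s ^ (-1 - β))) +
      (∫⁻ s in Ioo r₁ r₂, psi Ω x₀ u f s * ENNReal.ofReal (s ^ (-1 - β))) ≤
      ∫⁻ s in Ioo (0 : ℝ) r₂, psi Ω x₀ u f s * ENNReal.ofReal (s ^ (-1 - β)) := by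
    have hdis : Disjoint (Ioo (0 : ℝ) r₁) (Ioo r₁ r₂) :=
      Set.disjoint_left.2 fun s hs1 hs2 => lt_asymm hs1.2 hs2.1
    rw [← lintegral_union measurableSet_Ioo hdis]
    refine lintegral_mono_set (union_subset (Ioo_subset_Ioo_right h₁₂) (Ioo_subset_Ioo_left h₁.1.le))
  rw [monotoneQuantity, monotoneQuantity]
  calc _ ≤ _ := add_le_add_left h _
    _ = ENNReal.ofReal (r₂ ^ (-β)) * weightedEnergy Ω x₀ G r₂ + ENNReal.ofReal β *
        ((∫⁻ s in Ioo (0 : ℝ) r₁, psi Ω x₀ u f s * ENNReal.ofReal (s ^ (-1 - β))) +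
        (∫⁻ s in Ioo r₁ r₂, psi Ω x₀ u f s * ENNReal.ofReal (s ^ (-1 - β)))) := by ring
    _ ≤ _ := by gcongr

end Final

end ACF

end

theorem mainTheorem5 :
    ∃ C : ℕ → ℝ → ℝ → ℝ≥0,
      ∀ (N : ℕ) (Ω : Opens (ACF.Euc N)),
        IsConnected (Ω : Set (ACF.Euc N)) → Bornology.IsBounded (Ω : Set (ACF.Euc N)) →
      ∀ (q : ℝ≥0∞) (f u : ACF.Euc N → ℝ) (Du : ACF.Euc N → ACF.Euc N),
        1 ≤ q → MemLp f q (volume.restrict (Ω : Set (ACF.Euc N))) →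
        ACF.IsWeakSolution Ω f u Du →
      ∀ (x₀ : ACF.Euc N), x₀ ∈ closure (Ω : Set (ACF.Euc N)) →
      ∀ (r₀ σ' : ℝ), 0 < r₀ → σ' ∈ Ioo (0 : ℝ) ((N : ℝ) - 1) →
        ENNReal.ofReal σ' ≤
          (⨅ r ∈ Ioo (0 : ℝ) r₀, ENNReal.ofReal (r ^ 2) * ACF.sphericalEigenvalue Ω x₀ r) →
        ACF.betaExp N σ' ∈ Ioo (0 : ℝ) 2 ∧
        MonotoneOn (ACF.monotoneQuantity Ω x₀ u f Du (ACF.betaExp N σ')) (Ioo 0 r₀) ∧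
        ACF.weightedEnergy Ω x₀ Du (r₀ / 2) ≤
          C N r₀ (ACF.betaExp N σ') * eLpNorm Du 2 (volume.restrict (Ω : Set (ACF.Euc N))) ^ 2 +
            ACF.psi Ω x₀ u f r₀ := by
  -- The constant of `weightedEnergy_le` with r₁ = r₀/2 and r₂ = r₀.
  refine ⟨fun N r₀ β => Real.toNNReal
    ((r₀ / 2) ^ (2 - (N : ℝ) - β) / ((r₀ / 2) ^ (-β) - r₀ ^ (-β))), ?_⟩
  intro N Ω _ hΩ q f u Du hq hf hu x₀ _ r₀ σ' hr₀ hσ' hσ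
  -- Nonemptiness of the interval (0, N - 1) forces N ≥ 2.
  have hN : 2 ≤ N := by
    have h : (1 : ℝ) < N := by linarith [hσ'.1, hσ'.2]
    exact_mod_cast h
  have : IsFiniteMeasure (volume.restrict (Ω : Set (ACF.Euc N))) :=
    ⟨by simpa using hΩ.measure_lt_top⟩
  have hfi : IntegrableOn f Ω := hf.integrable hq
  have hβ := ACF.betaExp_mem_Ioo hN hσ'
  have hβσ := ACF.betaExp_mul (N := N) hσ'.1.le
  exact ⟨hβ, hu.monotoneOn hN hfi hσ'.1 hσ hβ.1 hβσ,
    hu.weightedEnergy_le hN hfi hr₀ hσ'.1 hσ hβ.1 hβσ (by linarith) (by linarith) le_rfl⟩
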